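/- Let $\mathbb T^d=\mathbb R^d/\mathbb Z^d$ with its Lebesgue measure $\mathscr L^d$. For a vector field $u:[0,T]\times\mathbb T^d\to\mathbb R^d$, a trajectory starting at $x\in\mathbb T^d$ is an absolutely continuous curve $\gamma:[0,T]\to\mathbb T^d$ with $\gamma(0)=x$ and $\dot\gamma(t)=u(t,\gamma(t))$ for all $t\in[0,T]$. For $0<\nu<1$ let $\mathcal C_\nu\subset\mathbb T^d$ be the Cantor set $\bigcap_{n\ge1}\bigcup_{s}\overline Q\big(P^n_\nu(s),2^{-(1+\nu)n}\big)$, where the union is over all $s=(s_1,\dots,s_n)$ with $s_i\in\{1,-1\}^d$, $\overline Q(c,\ell)$ is the closed cube with center $c$ and side length $\ell$, and $P^n_\nu(s)$ is the point with coordinates $\frac12+\frac14\sum_{i=1}^n s_i^j\,2^{-(1+\nu)(i-1)}$, $1\le j\le d$. Theorem. For every integer $d\ge2$, all real $1\le p<d$ and $0<\alpha<1$, and every $T>0$, there exists a vector field $$u\in C([0,T];W^{1,p}(\mathbb T^d,\mathbb R^d))\cap C^\alpha([0,T]\times\mathbb T^d,\mathbb R^d)$$ such that $u(t,\cdot)$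 is divergence-free for every $t\in[0,T]$, and such that for $\mathscr L^d$-almost every $x\in\mathbb T^d$ there are at least two different trajectories of $u$ on $[0,T]$ starting at $x$. Moreover, there are $\nu\in(0,1)$ with $\mathscr L^d(\mathcal C_\nu)=0$ and a map $X:[0,T]\times\mathbb T^d\to\mathbb T^d$ such that $X(\cdot,x)$ is a trajectory of $u$ starting at $x$ for every $x\in\mathbb T^d$, and $X(T,\mathbb T^d)\subseteq\mathcal C_\nu$. -/

import Mathlib

noncomputable section

open Set MeasureTheory Filter Topology
open scoped ENNReal NNReal ContDiff

namespace TorusODE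

/-- The torus `ℝ^d / ℤ^d`. Its volume is the Lebesgue measure of total mass one. -/
abbrev Torus (d : ℕ) : Type := UnitAddTorus (Fin d)

/-- Euclidean space `ℝ^d`. -/
abbrev Vec (d : ℕ) : Type := EuclideanSpace ℝ (Fin d)

/-- The covering map `ℝ^d → ℝ^d / ℤ^d`. -/
def proj {d : ℕ} (y : Vec d) : Torus d := fun i => (y i : UnitAddCircle)

/-- Smooth real functions on the torus: those whose periodic lift to `ℝ^d` is smooth. -/
def IsSmooth {d : ℕ} (φ : Torus d → ℝ) : Prop :=
  ContDiff ℝ ∞ (fun y : Vec d => φ (proj y))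

/-- The classical partial derivative `∂φ/∂x_i` on the torus. -/
def partialDeriv {d : ℕ} (i : Fin d) (φ : Torus d → ℝ) (x : Torus d) : ℝ :=
  deriv (fun s : ℝ => φ (x + Pi.single i (s : UnitAddCircle))) 0

/-- `G i` is the weak partial derivative `∂f/∂x_i` of the integrable vector field `f`, for
every `i`. -/
structure IsWeakGradient {d : ℕ} (f : Torus d → Vec d) (G : Fin d → Torus d → Vec d) :
    Prop where
  integrable : Integrable f
  integrable_grad : ∀ i, Integrable (G i)
  integral_eq : ∀ φ : Torus d → ℝ, IsSmooth φ → ∀ i,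
    ∫ x, partialDeriv i φ x • f x = - ∫ x, φ x • G i x

/-- Membership in the Sobolev space `W^{1,p}(𝕋^d, ℝ^d)`. -/
def MemW1p {d : ℕ} (p : ℝ≥0∞) (f : Torus d → Vec d) : Prop :=
  MemLp f p ∧ ∃ G, IsWeakGradient f G ∧ ∀ i, MemLp (G i) p

/-- The Sobolev norm `‖f‖_p + ∑ i, ‖∂f/∂x_i‖_p`. The weak gradient is unique up to null sets, so
the infimum is over one value if there is a weak gradient, and it is `∞` otherwise. -/
def w1pNorm {d : ℕ} (p : ℝ≥0∞) (f : Torus d → Vec d) : ℝ≥0∞ :=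
  eLpNorm f p + ⨅ (G : Fin d → Torus d → Vec d) (_ : IsWeakGradient f G), ∑ i, eLpNorm (G i) p

/-- `u ∈ C([0,T]; W^{1,p}(𝕋^d, ℝ^d))`. -/
def IsContinuousInW1p {d : ℕ} (p : ℝ≥0∞) (T : ℝ) (u : ℝ → Torus d → Vec d) : Prop :=
  ∀ t ∈ Icc 0 T, MemW1p p (u t) ∧
    Tendsto (fun s => w1pNorm p (u s - u t)) (𝓝[Icc 0 T] t) (𝓝 0)

/-- `u ∈ C^α([0,T] × 𝕋^d, ℝ^d)`. -/
def IsHolder {d : ℕ} (α : ℝ≥0) (T : ℝ) (u : ℝ → Torus d → Vec d) : Prop :=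
  ∃ C : ℝ≥0, HolderOnWith C α (fun z : ℝ × Torus d => u z.1 z.2) (Icc 0 T ×ˢ univ)

/-- `div f = 0` in the sense of distributions. -/
def IsDivergenceFree {d : ℕ} (f : Torus d → Vec d) : Prop :=
  Integrable f ∧ ∀ φ : Torus d → ℝ, IsSmooth φ → ∫ x, ∑ i, f x i * partialDeriv i φ x = 0

/-- `γ`, restricted to `[0,T]`, is a trajectory of `u` that starts at `x`: it is absolutely
continuous, `γ 0 = x`, and `γ' t = u t (γ t)` for every `t ∈ [0,T]` (one-sided derivatives at the
end points). The velocity of `γ` is that of a lift of `γ` to `ℝ^d`. -/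
structure IsTrajectory {d : ℕ} (T : ℝ) (u : ℝ → Torus d → Vec d) (x : Torus d)
    (γ : ℝ → Torus d) : Prop where
  absolutelyContinuous : AbsolutelyContinuousOnInterval γ 0 T
  start : γ 0 = x
  ode : ∃ g : ℝ → Vec d, (∀ t ∈ Icc 0 T, γ t = proj (g t)) ∧
    ∀ t ∈ Icc 0 T, HasDerivWithinAt g (u t (γ t)) (Icc 0 T) t

/-- The initial points from which there are at least two different trajectories on `[0,T]`. -/
def nonuniquenessSet {d : ℕ} (T : ℝ) (u : ℝ → Torus d → Vec d) : Set (Torus d) :=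
  {x | ∃ γ₁ γ₂ : ℝ → Torus d, IsTrajectory T u x γ₁ ∧ IsTrajectory T u x γ₂ ∧
    ∃ t ∈ Icc 0 T, γ₁ t ≠ γ₂ t}

/-- The side length `2^{-(1+ν)n}` of the cubes of generation `n` of the Cantor set. -/
def cubeLength (ν : ℝ) (n : ℕ) : ℝ := (2 : ℝ) ^ (-((1 + ν) * n))

/-- The center of the cube of generation `n` that the sequence `s` of `n` elements of `{1,-1}^d`
encodes: its `j`-th coordinate is `1/2 + (1/4) ∑_{k<n} s_k^j 2^{-(1+ν)k}`. -/
def cubeCenter {d : ℕ} (ν : ℝ) (n : ℕ) (s : Fin n → Fin d → ℤˣ) : Torus d := fun j =>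
  ((1 / 2 + 1 / 4 * ∑ k : Fin n, ((s k j : ℤ) : ℝ) * cubeLength ν k : ℝ) : UnitAddCircle)

/-- The closed cube of side length `l` centered at `c`. -/
def closedCube {d : ℕ} (c : Torus d) (l : ℝ) : Set (Torus d) := {x | ∀ j, ‖x j - c j‖ ≤ l / 2}

/-- The union of the `2^{nd}` closed cubes of generation `n`. -/
def cantorStage (d : ℕ) (ν : ℝ) (n : ℕ) : Set (Torus d) :=
  ⋃ s : Fin n → Fin d → ℤˣ, closedCube (cubeCenter ν n s) (cubeLength ν n)

/-- The Cantor set with ratio `2^{-(1+ν)}`. -/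
def cantorSet (d : ℕ) (ν : ℝ) : Set (Torus d) := ⋂ n ∈ Ici 1, cantorStage d ν n

end TorusODE

end

/-!
The field is a sum of blocks, one for each generation `n` of dyadic cells and each coordinate
direction `j`. Small cubes of generation `n + 1` start at the quarter points of the cells of
generation `n`, and the block moves them in direction `j` towards the center of the cell, until
their distance to the center is the one in the Cantor set. In the moving frame of generation `n`
the cells of generation `n + 1` fit into these cubes, so a point whose binary digits are given is
carried to the point of the Cantor set with the same digits. The finest generations move first:
the block `(n, j)` is active during `(T / Q ^ (m + 1), T / Q ^ m)` with `m = n * d + j`.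

A second copy of the field, with the origin of its cells shifted by `1 / 3`, has different end
points. Both families of curves are trajectories of the sum of the two fields: modulo one,
`2 ^ n / 3` is always `1 / 3` or `-1 / 3`, so that in every generation the moving cubes of one copy
are disjoint from those of the other.

Put `Q ^ d = 2 ^ ε`. The gradient of a block of generation `n` is of size `2 ^ (ν n) * Q ^ (d n)`
on a set of measure `2 ^ (-ν d n)`, so the field is continuous in `W^{1,p}` if
`ε < ν * (d / p - 1)`. It is `α`-Hölder if `(1 + α) * ε + α * (1 + ν) ≤ 1`.
-/

noncomputable section

open Set MeasureTheory Filter Topology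
open scoped ENNReal NNReal ContDiff

namespace TorusODE

/-! ### Amplitude and Lipschitz rate -/

/-- `f` is bounded by `A` and Lipschitz with constant `A * R`. The Lipschitz constant is measured
relative to the amplitude `A`, so that the rates `R` of the factors of a product add up. -/
structure IsControlled {X E : Type*} [PseudoMetricSpace X] [SeminormedAddCommGroup E] (A R : ℝ)
    (f : X → E) : Prop where
  rate_nonneg : 0 ≤ R
  norm_le : ∀ z, ‖f z‖ ≤ A
  norm_sub_le : ∀ z z', ‖f z - f z'‖ ≤ A * R * dist z z'

namespace IsControlled

section

variable {X E : Type*} [PseudoMetricSpace X] [SeminormedAddCommGroup E] {A B R S : ℝ}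
  {f g : X → E}

lemma amplitude_nonneg (h : IsControlled A R f) (z : X) : 0 ≤ A :=
  (norm_nonneg _).trans (h.norm_le z)

lemma mono (h : IsControlled A R f) (hA : A ≤ B) (hR : R ≤ S) : IsControlled B S f where
  rate_nonneg := h.rate_nonneg.trans hR
  norm_le z := (h.norm_le z).trans hA
  norm_sub_le z z' := by
    have hA0 := h.amplitude_nonneg z
    have hB0 := hA0.trans hA
    have hR0 := h.rate_nonneg
    exact (h.norm_sub_le z z').trans (by gcongr)

lemma add (hf : IsControlled A R f) (hg : IsControlled B R g) :
    IsControlled (A + B) R fun z => f z + g z where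
  rate_nonneg := hf.rate_nonneg
  norm_le z := norm_add_le_of_le (hf.norm_le z) (hg.norm_le z)
  norm_sub_le z z' := by
    rw [add_sub_add_comm, add_mul, add_mul]
    exact norm_add_le_of_le (hf.norm_sub_le z z') (hg.norm_sub_le z z')

lemma neg (h : IsControlled A R f) : IsControlled A R fun z => -f z where
  rate_nonneg := h.rate_nonneg
  norm_le z := (norm_neg _).trans_le (h.norm_le z)
  norm_sub_le z z' := by
    rw [neg_sub_neg, norm_sub_rev]
    exact h.norm_sub_le z z'

lemma sub (hf : IsControlled A R f) (hg : IsControlled B R g) :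
    IsControlled (A + B) R fun z => f z - g z := by
  simpa only [sub_eq_add_neg] using hf.add hg.neg

lemma const (hR : 0 ≤ R) (v : E) : IsControlled (X := X) ‖v‖ R fun _ => v where
  rate_nonneg := hR
  norm_le _ := le_rfl
  norm_sub_le z z' := by rw [sub_self, norm_zero]; positivity

lemma comp {Y : Type*} [PseudoMetricSpace Y] (h : IsControlled A R f) {K : ℝ} (hK : 0 ≤ K)
    {q : Y → X} (hq : ∀ z z', dist (q z) (q z') ≤ K * dist z z') :
    IsControlled A (R * K) fun z => f (q z) where
  rate_nonneg := mul_nonneg h.rate_nonneg hK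
  norm_le z := h.norm_le _
  norm_sub_le z z' := by
    have hA := h.amplitude_nonneg (q z)
    have hR := h.rate_nonneg
    calc ‖f (q z) - f (q z')‖ ≤ A * R * dist (q z) (q z') := h.norm_sub_le _ _
      _ ≤ A * R * (K * dist z z') := by gcongr; exact hq z z'
      _ = A * (R * K) * dist z z' := by ring

lemma continuous (h : IsControlled A R f) : Continuous f := by
  refine (LipschitzWith.of_dist_le_mul (K := (A * R).toNNReal) fun z z' => ?_).continuous
  rw [Real.coe_toNNReal _ (mul_nonneg (h.amplitude_nonneg z) h.rate_nonneg), dist_eq_norm]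
  exact h.norm_sub_le z z'

/-- The Hölder bound interpolates between the amplitude and the Lipschitz constant. -/
lemma norm_sub_le_rpow (h : IsControlled A R f) {α : ℝ} (h0 : 0 ≤ α) (h1 : α ≤ 1) (z z' : X) :
    ‖f z - f z'‖ ≤ 2 * (A * R ^ α) * dist z z' ^ α := by
  have hA := h.amplitude_nonneg z
  have hR := h.rate_nonneg
  rw [mul_assoc, mul_assoc, ← Real.mul_rpow hR dist_nonneg]
  rcases le_total (R * dist z z') 1 with hd | hd
  · calc ‖f z - f z'‖ ≤ A * (R * dist z z') ^ (1 : ℝ) := by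
          rw [Real.rpow_one, ← mul_assoc]; exact h.norm_sub_le z z'
      _ ≤ A * (R * dist z z') ^ α := by
          gcongr A * ?_; exact Real.rpow_le_rpow_of_exponent_ge' (by positivity) hd h0 h1
      _ ≤ 2 * (A * (R * dist z z') ^ α) := le_mul_of_one_le_left (by positivity) one_le_two
  · calc ‖f z - f z'‖ ≤ A + A := norm_sub_le_of_le (h.norm_le z) (h.norm_le z')
      _ = 2 * (A * 1) := by ring
      _ ≤ 2 * (A * (R * dist z z') ^ α) := by gcongr; exact Real.one_le_rpow hd h0

end

section

variable {X E : Type*} [PseudoMetricSpace X] [SeminormedAddCommGroup E] [NormedSpace ℝ E]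
  {A B R S : ℝ}

lemma smul {a : X → ℝ} {f : X → E} (ha : IsControlled A R a) (hf : IsControlled B S f) :
    IsControlled (A * B) (R + S) fun z => a z • f z where
  rate_nonneg := add_nonneg ha.rate_nonneg hf.rate_nonneg
  norm_le z := by
    rw [norm_smul]
    exact mul_le_mul (ha.norm_le z) (hf.norm_le z) (norm_nonneg _) (ha.amplitude_nonneg z)
  norm_sub_le z z' := by
    have hA := ha.amplitude_nonneg z
    have hR := ha.rate_nonneg
    calc ‖a z • f z - a z' • f z'‖
        = ‖a z • (f z - f z') + (a z - a z') • f z'‖ := by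
          rw [smul_sub, sub_smul, sub_add_sub_cancel]
      _ ≤ ‖a z‖ * ‖f z - f z'‖ + ‖a z - a z'‖ * ‖f z'‖ :=
          norm_add_le_of_le (norm_smul_le _ _) (norm_smul_le _ _)
      _ ≤ A * (B * S * dist z z') + A * R * dist z z' * B := by
          gcongr
          · exact ha.norm_le z
          · exact hf.norm_sub_le z z'
          · exact ha.norm_sub_le z z'
          · exact hf.norm_le z'
      _ = A * B * (R + S) * dist z z' := by ring

lemma const_smul {f : X → E} (hf : IsControlled A R f) (c : ℝ) :
    IsControlled (‖c‖ * A) R fun z => c • f z := by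
  simpa only [zero_add] using (const le_rfl c).smul hf

lemma smul_const {a : X → ℝ} (ha : IsControlled A R a) (v : E) :
    IsControlled (A * ‖v‖) R fun z => a z • v := by
  simpa only [add_zero] using ha.smul (const le_rfl v)

lemma prod {ι : Type*} (s : Finset ι) {a : ι → X → ℝ} (ha : ∀ i, IsControlled A R (a i)) :
    IsControlled (A ^ s.card) (s.card * R) fun z => ∏ i ∈ s, a i z := by
  classical
  induction s using Finset.induction_on with
  | empty => simpa using const (X := X) le_rfl (1 : ℝ)
  | insert i s hi ih =>
    simp only [Finset.prod_insert hi, Finset.card_insert_of_notMem hi, Nat.cast_succ, pow_succ',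
      add_one_mul, add_comm _ R]
    exact (ha i).smul ih

end

end IsControlled

/-! ### Families with one active member -/

section

variable {ι T E : Type*} [AddCommGroup E] [TopologicalSpace E] {V : ι → T → E}

lemma exists_finset_tsum_sub_tsum_eq (h : ∀ t, ∃ m, ∀ m' ≠ m, V m' t = 0) (s t : T) :
    ∃ F : Finset ι, F.card ≤ 2 ∧ ∑' m, V m s - ∑' m, V m t = ∑ m ∈ F, (V m s - V m t) := by
  classical
  obtain ⟨m, hm⟩ := h s
  obtain ⟨m', hm'⟩ := h t
  refine ⟨{m, m'}, Finset.card_le_two, ?_⟩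
  have hne : ∀ n ∉ ({m, m'} : Finset ι), n ≠ m ∧ n ≠ m' := fun n hn => by simpa using hn
  rw [Finset.sum_sub_distrib, tsum_eq_sum fun n hn => hm n (hne n hn).1,
    tsum_eq_sum fun n hn => hm' n (hne n hn).2]

end

section

variable {ι X E : Type*} [MeasurableSpace X] {μ : Measure X} [NormedAddCommGroup E] {p : ℝ≥0∞}
  {V : ι → ℝ → X → E}

lemma eventually_forall_eLpNorm_sub_le (hp : 1 ≤ p) (hV : ∀ m t, AEStronglyMeasurable (V m t) μ)
    (hsmall : ∀ ε : ℝ≥0∞, 0 < ε → ∀ᶠ m in cofinite, ∀ t, eLpNorm (V m t) p μ ≤ ε)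
    (hcont : ∀ m t, Tendsto (fun s => eLpNorm (V m s - V m t) p μ) (𝓝 t) (𝓝 0)) (t : ℝ)
    {ε : ℝ≥0∞} (hε : 0 < ε) : ∀ᶠ s in 𝓝 t, ∀ m, eLpNorm (V m s - V m t) p μ ≤ ε := by
  have hfin : {m | ¬ ∀ t, eLpNorm (V m t) p μ ≤ ε / 2}.Finite :=
    hsmall _ (ENNReal.half_pos hε.ne')
  filter_upwards [(Filter.eventually_all_finite hfin).2 fun m _ =>
    ENNReal.tendsto_nhds_zero.1 (hcont m t) ε hε] with s hs m
  by_cases hm : ∀ t, eLpNorm (V m t) p μ ≤ ε / 2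
  · calc eLpNorm (V m s - V m t) p μ ≤ eLpNorm (V m s) p μ + eLpNorm (V m t) p μ :=
          eLpNorm_sub_le (hV m s) (hV m t) hp
      _ ≤ ε / 2 + ε / 2 := add_le_add (hm s) (hm t)
      _ = ε := ENNReal.add_halves ε
  · exact hs m hm

lemma tendsto_eLpNorm_tsum_sub (hp : 1 ≤ p)
    (hV : ∀ m t, AEStronglyMeasurable (V m t) μ)
    (hdisj : ∀ t, ∃ m, ∀ m' ≠ m, V m' t = 0)
    (hsmall : ∀ ε : ℝ≥0∞, 0 < ε → ∀ᶠ m in cofinite, ∀ t, eLpNorm (V m t) p μ ≤ ε)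
    (hcont : ∀ m t, Tendsto (fun s => eLpNorm (V m s - V m t) p μ) (𝓝 t) (𝓝 0)) (t : ℝ) :
    Tendsto (fun s => eLpNorm (∑' m, V m s - ∑' m, V m t) p μ) (𝓝 t) (𝓝 0) := by
  rw [ENNReal.tendsto_nhds_zero]
  intro ε hε
  filter_upwards [eventually_forall_eLpNorm_sub_le hp hV hsmall hcont t
    (ENNReal.half_pos hε.ne')] with s hs
  obtain ⟨F, hF, hsum⟩ := exists_finset_tsum_sub_tsum_eq hdisj s t
  rw [hsum]
  calc eLpNorm (∑ m ∈ F, (V m s - V m t)) p μ ≤ ∑ m ∈ F, eLpNorm (V m s - V m t) p μ :=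
        eLpNorm_sum_le (fun m _ => (hV m s).sub (hV m t)) hp
    _ ≤ F.card • (ε / 2) := Finset.sum_le_card_nsmul F _ _ fun m _ => hs m
    _ ≤ 2 • (ε / 2) := by gcongr
    _ = ε := by rw [two_nsmul, ENNReal.add_halves]

end

lemma eLpNorm_le_of_support_subset {X E : Type*} [MeasurableSpace X] {μ : Measure X}
    [NormedAddCommGroup E] {f : X → E} {C : ℝ} {s : Set X} (hC : ∀ x, ‖f x‖ ≤ C)
    (hs : Function.support f ⊆ s) (p : ℝ≥0∞) :
    eLpNorm f p μ ≤ μ s ^ p.toReal⁻¹ * ENNReal.ofReal C := by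
  rw [← eLpNorm_restrict_eq_of_support_subset hs, ← Measure.restrict_apply_univ s]
  exact eLpNorm_le_of_ae_bound (.of_forall hC)

lemma tendsto_eLpNorm_add_sub {X E : Type*} [MeasurableSpace X] [NormedAddCommGroup E]
    {μ : Measure X} {p : ℝ≥0∞} (hp : 1 ≤ p) {V W : ℝ → X → E}
    (hVm : ∀ t, AEStronglyMeasurable (V t) μ) (hWm : ∀ t, AEStronglyMeasurable (W t) μ) {t : ℝ}
    (hV : Tendsto (fun s => eLpNorm (V s - V t) p μ) (𝓝 t) (𝓝 0))
    (hW : Tendsto (fun s => eLpNorm (W s - W t) p μ) (𝓝 t) (𝓝 0)) :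
    Tendsto (fun s => eLpNorm (V s + W s - (V t + W t)) p μ) (𝓝 t) (𝓝 0) := by
  refine tendsto_of_tendsto_of_tendsto_of_le_of_le tendsto_const_nhds
    (add_zero (0 : ℝ≥0∞) ▸ hV.add hW) (fun _ => zero_le) fun s => ?_
  rw [add_sub_add_comm]
  exact eLpNorm_add_le ((hVm s).sub (hVm t)) ((hWm s).sub (hWm t)) hp

/-! ### The circle -/

lemma norm_coe_le_abs (y : ℝ) : ‖(y : UnitAddCircle)‖ ≤ |y| := QuotientAddGroup.norm_mk_le_norm

lemma dist_coe_coe_le (x y : ℝ) : dist (x : UnitAddCircle) y ≤ dist x y := by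
  rw [dist_eq_norm, ← AddCircle.coe_sub, Real.dist_eq]
  exact norm_coe_le_abs _

lemma le_norm_coe {l y : ℝ} (h : l ≤ |y|) (h' : |y| ≤ 1 - l) : l ≤ ‖(y : UnitAddCircle)‖ := by
  rw [UnitAddCircle.norm_eq]
  by_cases hk : round y = 0
  · simpa [hk] using h
  · have h1 : (1 : ℝ) ≤ |(round y : ℝ)| := by exact_mod_cast Int.one_le_abs hk
    rw [abs_sub_comm]
    linarith [abs_sub_abs_le_abs_sub (round y : ℝ) y]

lemma coe_intCast (k : ℤ) : ((k : ℝ) : UnitAddCircle) = 0 :=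
  (AddCircle.coe_eq_zero_iff 1).2 ⟨k, by simp⟩

lemma coe_sub_intCast (y : ℝ) (k : ℤ) : ((y - k : ℝ) : UnitAddCircle) = y := by
  rw [AddCircle.coe_sub, coe_intCast, sub_zero]

lemma exists_coe_eq_sub (y y' : ℝ) :
    ∃ z : ℝ, (z : UnitAddCircle) = y ∧ dist z y' = dist (y : UnitAddCircle) y' := by
  refine ⟨y - round (y - y'), coe_sub_intCast _ _, ?_⟩
  rw [dist_eq_norm (y : UnitAddCircle), ← AddCircle.coe_sub, UnitAddCircle.norm_eq, Real.dist_eq,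
    sub_right_comm]

lemma third_le_norm_coe {m : ℤ} (hm : ¬ 3 ∣ m) : 1 / 3 ≤ ‖((m / 3 : ℝ) : UnitAddCircle)‖ := by
  set k := round (m / 3 : ℝ)
  have hne : m - 3 * k ≠ 0 := fun h => hm ⟨k, by omega⟩
  have h1 : (1 : ℝ) ≤ |(m - 3 * k : ℝ)| := by exact_mod_cast Int.one_le_abs hne
  have e : (m / 3 : ℝ) - k = (m - 3 * k) / 3 := by ring
  rw [UnitAddCircle.norm_eq, e, abs_div, abs_of_pos (zero_lt_three' ℝ)]
  linarith

lemma volume_closedBall_le (x : UnitAddCircle) (l : ℝ) :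
    volume (Metric.closedBall x l) ≤ ENNReal.ofReal (2 * l) := by
  rw [AddCircle.volume_closedBall]
  exact ENNReal.ofReal_le_ofReal (min_le_right _ _)

lemma volume_union_closedBall_le {l : ℝ} (hl : 0 ≤ l) (x y : UnitAddCircle) :
    volume (Metric.closedBall x l ∪ Metric.closedBall y l) ≤ ENNReal.ofReal (4 * l) :=
  calc volume (Metric.closedBall x l ∪ Metric.closedBall y l)
      ≤ ENNReal.ofReal (2 * l) + ENNReal.ofReal (2 * l) :=
        (measure_union_le _ _).trans
          (add_le_add (volume_closedBall_le x l) (volume_closedBall_le y l))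
    _ = ENNReal.ofReal (4 * l) := by
        rw [← ENNReal.ofReal_add (by positivity) (by positivity)]
        ring_nf

/-! ### Bumps on the line and on the circle -/

lemma eventually_isControlled {φ : ℝ → ℝ} (h : ContDiff ℝ ∞ φ) (hc : HasCompactSupport φ) :
    ∀ᶠ M in atTop, IsControlled M 1 φ := by
  obtain ⟨C, hC⟩ := h.continuous.bounded_above_of_compact_support hc
  obtain ⟨K, hK⟩ := (h.of_le (by simp)).lipschitzWith_of_hasCompactSupport hc one_ne_zero
  filter_upwards [eventually_ge_atTop C, eventually_ge_atTop (K : ℝ)] with M hM hM'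
  refine ⟨zero_le_one, fun y => (hC y).trans hM, fun y y' => ?_⟩
  rw [← dist_eq_norm, mul_one]
  exact (hK.dist_le_mul y y').trans (by gcongr)

lemma IsControlled.norm_deriv_le {φ : ℝ → ℝ} {A R : ℝ} (h : IsControlled A R φ) (y : ℝ) :
    ‖deriv φ y‖ ≤ A * R := by
  have h0 : 0 ≤ A * R := mul_nonneg (h.amplitude_nonneg 0) h.rate_nonneg
  refine norm_deriv_le_of_lip' h0 (.of_forall fun z => ?_)
  rw [← dist_eq_norm z y]
  exact h.norm_sub_le z y

/-- Smooth functions on `ℝ` with compact support in `(-1, 1)`. -/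
structure IsBump (φ : ℝ → ℝ) : Prop where
  smooth : ContDiff ℝ ∞ φ
  tsupport_subset : tsupport φ ⊆ Ioo (-1) 1

namespace IsBump

variable {φ : ℝ → ℝ}

lemma eq_zero (h : IsBump φ) {y : ℝ} (hy : 1 ≤ |y|) : φ y = 0 := by
  by_contra hne
  exact hy.not_gt (abs_lt.2 (h.tsupport_subset (subset_tsupport φ hne)))

lemma hasCompactSupport (h : IsBump φ) : HasCompactSupport φ :=
  isCompact_Icc.of_isClosed_subset (isClosed_tsupport φ)
    (h.tsupport_subset.trans Ioo_subset_Icc_self)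

lemma deriv (h : IsBump φ) : IsBump (deriv φ) where
  smooth := (contDiff_infty_iff_deriv.1 h.smooth).2
  tsupport_subset :=
    (closure_minimal support_deriv_subset (isClosed_tsupport φ)).trans h.tsupport_subset

lemma iteratedDeriv (h : IsBump φ) (m : ℕ) : IsBump (iteratedDeriv m φ) := by
  induction m with
  | zero => simpa only [iteratedDeriv_zero] using h
  | succ m ih => simpa only [iteratedDeriv_succ] using ih.deriv

lemma hasDerivAt (h : IsBump φ) (y : ℝ) : HasDerivAt φ (_root_.deriv φ y) y :=
  (h.smooth.differentiable (by simp) y).hasDerivAt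

lemma id_mul (h : IsBump φ) : IsBump fun y => y * φ y where
  smooth := contDiff_id.mul h.smooth
  tsupport_subset := tsupport_mul_subset_right.trans h.tsupport_subset

lemma eventually_forall_isControlled (h : IsBump φ) (N : ℕ) :
    ∀ᶠ M in atTop, ∀ m ≤ N, IsControlled M 1 (_root_.iteratedDeriv m φ) :=
  (eventually_all_finite (finite_le_nat N)).2 fun m _ =>
    eventually_isControlled (h.iteratedDeriv m).smooth (h.iteratedDeriv m).hasCompactSupport

end IsBump

/-- A function that is supported in `(-1, 1)`, scaled by `l` and repeated with period one. -/
def periodize (φ : ℝ → ℝ) (l : ℝ) : UnitAddCircle → ℝ :=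
  Function.Periodic.lift (f := fun y : ℝ => φ ((y - round y) / l)) (c := 1) fun y => by
    simp [round_add_one]

lemma periodize_coe (φ : ℝ → ℝ) (l y : ℝ) :
    periodize φ l (y : UnitAddCircle) = φ ((y - round y) / l) := rfl

lemma periodize_coe_of_abs_lt (φ : ℝ → ℝ) (l : ℝ) {y : ℝ} (hy : |y| < 1 / 2) :
    periodize φ l (y : UnitAddCircle) = φ (y / l) := by
  have hround : round y = 0 := by
    rw [round_eq_zero_iff]
    constructor <;> linarith [abs_lt.1 hy]
  rw [periodize_coe, hround, Int.cast_zero, sub_zero]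

namespace IsBump

variable {φ : ℝ → ℝ} {l : ℝ}

lemma periodize_eq_zero (h : IsBump φ) (hl : 0 < l) {ξ : UnitAddCircle} (hξ : l ≤ ‖ξ‖) :
    periodize φ l ξ = 0 := by
  induction ξ using QuotientAddGroup.induction_on with
  | H y =>
    refine h.eq_zero ?_
    rwa [abs_div, abs_of_pos hl, one_le_div hl, ← UnitAddCircle.norm_eq]

lemma hasDerivAt_periodize_coe (h : IsBump φ) (hl : 0 < l) (hl' : l < 1 / 4) (y : ℝ) :
    HasDerivAt (fun s : ℝ => periodize φ l (s : UnitAddCircle))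
      (periodize (_root_.deriv φ) l (y : UnitAddCircle) / l) y := by
  by_cases hy : l < ‖(y : UnitAddCircle)‖
  · have hnorm : Continuous fun s : ℝ => ‖(s : UnitAddCircle)‖ :=
      continuous_norm.comp (AddCircle.continuous_mk' 1)
    rw [h.deriv.periodize_eq_zero hl hy.le, zero_div]
    refine (hasDerivAt_const y (0 : ℝ)).congr_of_eventuallyEq ?_
    filter_upwards [hnorm.continuousAt.eventually (lt_mem_nhds hy)] with s hs
    exact h.periodize_eq_zero hl hs.le
  · rw [UnitAddCircle.norm_eq, not_lt] at hy
    have hcont : Continuous fun s : ℝ => |s - round y| := by fun_prop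
    have hlocal : (fun s : ℝ => periodize φ l (s : UnitAddCircle)) =ᶠ[𝓝 y]
        fun s => φ ((s - round y) / l) := by
      filter_upwards [hcont.continuousAt.eventually
        (gt_mem_nhds (hy.trans_lt (by linarith : l < 1 / 2)))] with s hs
      rw [← coe_sub_intCast s (round y), periodize_coe_of_abs_lt φ l hs]
    have hd := (h.hasDerivAt ((y - round y) / l)).comp y
      (((hasDerivAt_id y).sub_const (round y : ℝ)).div_const l)
    rw [periodize_coe]
    exact (hd.congr_deriv (by ring)).congr_of_eventuallyEq hlocal

lemma hasDerivAt_periodize_add (h : IsBump φ) (hl : 0 < l) (hl' : l < 1 / 4) (ξ : UnitAddCircle)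
    (c : ℝ) :
    HasDerivAt (fun s : ℝ => periodize φ l (ξ + ((c * s : ℝ) : UnitAddCircle)))
      (c / l * periodize (_root_.deriv φ) l ξ) 0 := by
  induction ξ using QuotientAddGroup.induction_on with
  | H y =>
    have hline : HasDerivAt (fun s : ℝ => y + c * s) c 0 := by
      simpa using ((hasDerivAt_id (0 : ℝ)).const_mul c).const_add y
    have hcomp := (h.hasDerivAt_periodize_coe hl hl' (y + c * 0)).comp (0 : ℝ) hline
    simp only [mul_zero, add_zero] at hcomp
    exact hcomp.congr_deriv (by ring)

lemma isControlled_periodize (h : IsBump φ) {M : ℝ} (hM : IsControlled M 1 φ) (hl : 0 < l)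
    (hl' : l < 1 / 4) : IsControlled M (1 / l) (periodize φ l) where
  rate_nonneg := by positivity
  norm_le ξ := by
    induction ξ using QuotientAddGroup.induction_on with
    | H y => exact hM.norm_le _
  norm_sub_le ξ ξ' := by
    induction ξ using QuotientAddGroup.induction_on with
    | H y =>
    induction ξ' using QuotientAddGroup.induction_on with
    | H y' =>
      obtain ⟨z, hz, hdist⟩ := exists_coe_eq_sub y y'
      have hbound : ∀ s : ℝ, ‖periodize (_root_.deriv φ) l (s : UnitAddCircle) / l‖ ≤
          M * (1 / l) := fun s => by
        rw [norm_div, Real.norm_of_nonneg hl.le, mul_one_div]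
        gcongr
        exact (hM.norm_deriv_le _).trans_eq (mul_one M)
      have := Convex.norm_image_sub_le_of_norm_hasDerivWithin_le
        (fun s _ => (h.hasDerivAt_periodize_coe hl hl' s).hasDerivWithinAt)
        (fun s _ => hbound s) convex_univ (mem_univ y') (mem_univ z)
      rwa [hz, ← dist_eq_norm z, hdist] at this

end IsBump

/-- Two periodized copies of `φ`, centered at `1/2 + r` and `1/2 - r`, the second with the
weight `σ`. -/
def pairBump (φ : ℝ → ℝ) (σ l r : ℝ) (ξ : UnitAddCircle) : ℝ :=
  periodize φ l (ξ - ((1 / 2 + r : ℝ) : UnitAddCircle)) +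
    σ * periodize φ l (ξ - ((1 / 2 - r : ℝ) : UnitAddCircle))

namespace IsBump

variable {φ : ℝ → ℝ} {l : ℝ}

lemma isControlled_pairBump (h : IsBump φ) {M : ℝ} (hM : IsControlled M 1 φ) {σ : ℝ}
    (hσ : |σ| = 1) (hl : 0 < l) (hl' : l < 1 / 4) {Z : Type*} [PseudoMetricSpace Z] {r : Z → ℝ}
    {ξ : Z → UnitAddCircle} {Kr Kξ : ℝ} (hKr : 0 ≤ Kr) (hKξ : 0 ≤ Kξ)
    (hr : ∀ z z', dist (r z) (r z') ≤ Kr * dist z z')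
    (hξ : ∀ z z', dist (ξ z) (ξ z') ≤ Kξ * dist z z') :
    IsControlled (2 * M) ((Kξ + Kr) / l) fun z => pairBump φ σ l (r z) (ξ z) := by
  have copy : ∀ c : ℝ → ℝ, Isometry c →
      IsControlled M ((Kξ + Kr) / l) fun z => periodize φ l (ξ z - (c (r z) : UnitAddCircle)) := by
    intro c hc
    rw [← one_div_mul_eq_div]
    refine (h.isControlled_periodize hM hl hl').comp (add_nonneg hKξ hKr) fun z z' => ?_
    rw [add_mul]
    refine (dist_sub_sub_le _ _ _ _).trans (add_le_add (hξ z z') ?_)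
    exact ((dist_coe_coe_le _ _).trans_eq (hc.dist_eq _ _)).trans (hr z z')
  have hplus := copy (fun y => 1 / 2 + y) (Isometry.of_dist_eq fun y y' => dist_add_left _ _ _)
  have hminus := copy (fun y => 1 / 2 - y) (Isometry.of_dist_eq fun y y' => dist_sub_left _ _ _)
  have hsum := hplus.add (hminus.const_smul σ)
  rwa [Real.norm_eq_abs, hσ, one_mul, ← two_mul] at hsum

lemma hasDerivAt_pairBump_add (h : IsBump φ) (hl : 0 < l) (hl' : l < 1 / 4) (σ r c : ℝ)
    (ξ : UnitAddCircle) :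
    HasDerivAt (fun s : ℝ => pairBump φ σ l r (ξ + ((c * s : ℝ) : UnitAddCircle)))
      (c / l * pairBump (_root_.deriv φ) σ l r ξ) 0 := by
  have hplus := h.hasDerivAt_periodize_add hl hl' (ξ - ((1 / 2 + r : ℝ) : UnitAddCircle)) c
  have hminus := h.hasDerivAt_periodize_add hl hl' (ξ - ((1 / 2 - r : ℝ) : UnitAddCircle)) c
  simp only [pairBump, add_sub_right_comm]
  exact (hplus.fun_add (hminus.const_mul σ)).congr_deriv (by ring)

lemma pairBump_eq_zero (h : IsBump φ) (hl : 0 < l) (σ : ℝ) {r : ℝ} {ξ : UnitAddCircle}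
    (hplus : l ≤ ‖ξ - ((1 / 2 + r : ℝ) : UnitAddCircle)‖)
    (hminus : l ≤ ‖ξ - ((1 / 2 - r : ℝ) : UnitAddCircle)‖) : pairBump φ σ l r ξ = 0 := by
  rw [pairBump, h.periodize_eq_zero hl hplus, h.periodize_eq_zero hl hminus, mul_zero, add_zero]

lemma pairBump_coe (h : IsBump φ) (hl : 0 < l) {r e : ℝ} (hr : l ≤ r) (hr' : r ≤ 1 / 4)
    (he : |e| ≤ l) (σ : ℝ) (s : ℤˣ) :
    pairBump φ σ l r ((1 / 2 + (s : ℤ) * r + e : ℝ) : UnitAddCircle) =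
      (if s = 1 then 1 else σ) * φ (e / l) := by
  obtain ⟨he₁, he₂⟩ := abs_le.1 he
  have hnear : periodize φ l (e : UnitAddCircle) = φ (e / l) :=
    periodize_coe_of_abs_lt φ l (abs_lt.2 ⟨by linarith, by linarith⟩)
  rw [pairBump, ← AddCircle.coe_sub, ← AddCircle.coe_sub]
  rcases Int.units_eq_one_or s with rfl | rfl
  · have hfar : periodize φ l ((2 * r + e : ℝ) : UnitAddCircle) = 0 :=
      h.periodize_eq_zero hl (le_norm_coe (le_abs.2 (.inl (by linarith)))
        (abs_le.2 ⟨by linarith, by linarith⟩))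
    rw [show 1 / 2 + (((1 : ℤˣ) : ℤ) : ℝ) * r + e - (1 / 2 + r) = e by simp,
      show 1 / 2 + (((1 : ℤˣ) : ℤ) : ℝ) * r + e - (1 / 2 - r) = 2 * r + e by simp; ring,
      hnear, hfar, if_pos rfl, mul_zero, add_zero, one_mul]
  · have hfar : periodize φ l ((-(2 * r) + e : ℝ) : UnitAddCircle) = 0 :=
      h.periodize_eq_zero hl (le_norm_coe (le_abs.2 (.inr (by linarith)))
        (abs_le.2 ⟨by linarith, by linarith⟩))
    rw [show 1 / 2 + (((-1 : ℤˣ) : ℤ) : ℝ) * r + e - (1 / 2 + r) = -(2 * r) + e by simp; ring,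
      show 1 / 2 + (((-1 : ℤˣ) : ℤ) : ℝ) * r + e - (1 / 2 - r) = e by simp; ring,
      hnear, hfar, if_neg (by decide), zero_add]

end IsBump

/-! ### Differentiation and integration on the torus -/

section

variable {d : ℕ}

lemma isOpenQuotientMap_proj : IsOpenQuotientMap (proj : Vec d → Torus d) :=
  (IsOpenQuotientMap.piMap fun _ : Fin d => QuotientAddGroup.isOpenQuotientMap_mk).comp
    (EuclideanSpace.equiv (Fin d) ℝ).toHomeomorph.isOpenQuotientMap

lemma proj_add_smul_single (y : Vec d) (i : Fin d) (s : ℝ) :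
    proj (y + s • EuclideanSpace.single i (1 : ℝ)) =
      proj y + Pi.single i (s : UnitAddCircle) := by
  funext j
  rcases eq_or_ne j i with rfl | h
  · simp [proj]
  · simp [proj, h]

/-- `f'` is the classical partial derivative `∂f/∂x_i` at `x`. -/
abbrev HasPartialDerivAt {E : Type*} [NormedAddCommGroup E] [NormedSpace ℝ E] (i : Fin d)
    (f : Torus d → E) (f' : E) (x : Torus d) : Prop :=
  HasDerivAt (fun s : ℝ => f (x + Pi.single i (s : UnitAddCircle))) f' 0

namespace IsSmooth

variable {φ : Torus d → ℝ}

lemma continuous (h : IsSmooth φ) : Continuous φ :=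
  isOpenQuotientMap_proj.isQuotientMap.continuous_iff.2 (ContDiff.continuous h)

lemma hasPartialDerivAt_proj (h : IsSmooth φ) (i : Fin d) (y : Vec d) :
    HasPartialDerivAt i φ (fderiv ℝ (fun y => φ (proj y)) y (EuclideanSpace.single i 1))
      (proj y) := by
  have hline : HasDerivAt (fun s : ℝ => y + s • EuclideanSpace.single i (1 : ℝ))
      (EuclideanSpace.single i 1) 0 := by
    simpa using ((hasDerivAt_id (0 : ℝ)).smul_const (EuclideanSpace.single i (1 : ℝ))).const_add y
  have hφ : HasFDerivAt (fun y => φ (proj y)) (fderiv ℝ (fun y => φ (proj y)) y)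
      (y + (0 : ℝ) • EuclideanSpace.single i (1 : ℝ)) := by
    rw [zero_smul, add_zero]
    exact (ContDiff.differentiable h (by simp) y).hasFDerivAt
  simpa only [Function.comp_def, proj_add_smul_single] using hφ.comp_hasDerivAt (0 : ℝ) hline

lemma hasPartialDerivAt (h : IsSmooth φ) (i : Fin d) (x : Torus d) :
    HasPartialDerivAt i φ (partialDeriv i φ x) x := by
  obtain ⟨y, rfl⟩ := isOpenQuotientMap_proj.surjective x
  exact (h.hasPartialDerivAt_proj i y).differentiableAt.hasDerivAt

lemma continuous_partialDeriv (h : IsSmooth φ) (i : Fin d) : Continuous (partialDeriv i φ) := by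
  have hlift : partialDeriv i φ ∘ proj =
      fun y => fderiv ℝ (fun y => φ (proj y)) y (EuclideanSpace.single i 1) :=
    funext fun y => (h.hasPartialDerivAt_proj i y).deriv
  rw [isOpenQuotientMap_proj.isQuotientMap.continuous_iff, hlift]
  exact (ContDiff.continuous_fderiv h (by simp)).clm_apply continuous_const

end IsSmooth

variable {E : Type*} [NormedAddCommGroup E]

lemma integrable_of_continuous {f : Torus d → E} (hf : Continuous f) : Integrable f :=
  hf.integrable_of_hasCompactSupport (HasCompactSupport.of_compactSpace f)

lemma memLp_of_continuous {f : Torus d → E} (hf : Continuous f) (p : ℝ≥0∞) : MemLp f p := by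
  obtain ⟨C, hC⟩ := isCompact_univ.exists_bound_of_continuousOn hf.continuousOn
  exact MemLp.of_bound (integrable_of_continuous hf).aestronglyMeasurable C
    (.of_forall fun x => hC x (mem_univ x))

variable [NormedSpace ℝ E] {f g : Torus d → E} {i : Fin d}

lemma hasDerivAt_translate (h : ∀ x, HasPartialDerivAt i f (g x) x) (x : Torus d) (s : ℝ) :
    HasDerivAt (fun s : ℝ => f (x + Pi.single i (s : UnitAddCircle)))
      (g (x + Pi.single i (s : UnitAddCircle))) s := by
  have h0 := h (x + Pi.single i (s : UnitAddCircle))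
  rw [HasPartialDerivAt, ← sub_self s] at h0
  refine (h0.comp_sub_const s s).congr_of_eventuallyEq (.of_forall fun s' => ?_)
  simp only [add_assoc, ← Pi.single_add, ← AddCircle.coe_add, add_sub_cancel]

/-- The integral of the translates of `f` is constant, and the integral of `∂f/∂x_i` is its
derivative. -/
lemma integral_eq_zero_of_hasPartialDerivAt (hf : Continuous f) (hg : Continuous g)
    (h : ∀ x, HasPartialDerivAt i f (g x) x) : ∫ x, g x = 0 := by
  obtain ⟨C, hC⟩ := isCompact_univ.exists_bound_of_continuousOn hg.continuousOn
  let F (k : Torus d → E) (s : ℝ) (x : Torus d) : E := k (x + Pi.single i (s : UnitAddCircle))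
  have hF : ∀ (k : Torus d → E) (s : ℝ), Continuous k → Integrable (F k s) := fun k s hk =>
    integrable_of_continuous (hk.comp (continuous_id.add continuous_const))
  have hderiv : HasDerivAt (fun s => ∫ x, F f s x) (∫ x, F g 0 x) 0 :=
    (hasDerivAt_integral_of_dominated_loc_of_deriv_le (μ := (volume : Measure (Torus d)))
      (F := F f) (F' := F g) (x₀ := (0 : ℝ)) (s := univ) (bound := fun _ => C) univ_mem
      (.of_forall fun s => (hF f s hf).aestronglyMeasurable) (hF f 0 hf)
      (hF g 0 hg).aestronglyMeasurable (.of_forall fun x s _ => hC _ (mem_univ _))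
      (integrable_const C) (.of_forall fun x s _ => hasDerivAt_translate h x s)).2
  have hconst : ∀ (k : Torus d → E) (s : ℝ), ∫ x, F k s x = ∫ x, k x := fun k s =>
    integral_add_right_eq_self k _
  simp only [hconst] at hderiv
  exact hderiv.unique (hasDerivAt_const _ _)

lemma integral_smul_add_partialDeriv_smul {φ : Torus d → ℝ} (hφ : IsSmooth φ) (hf : Continuous f)
    (hg : Continuous g) (h : ∀ x, HasPartialDerivAt i f (g x) x) :
    ∫ x, (φ x • g x + partialDeriv i φ x • f x) = 0 :=
  integral_eq_zero_of_hasPartialDerivAt (f := fun x => φ x • f x) (hφ.continuous.smul hf)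
    ((hφ.continuous.smul hg).add ((hφ.continuous_partialDeriv i).smul hf)) fun x => by
      simpa only [AddCircle.coe_zero, Pi.single_zero, add_zero] using
        (hφ.hasPartialDerivAt i x).fun_smul (h x)

end

/-- `G i` is the classical continuous partial derivative `∂f/∂x_i`, for every `i`. -/
structure HasGradient {d : ℕ} (f : Torus d → Vec d) (G : Fin d → Torus d → Vec d) : Prop where
  continuous : Continuous f
  continuous_grad : ∀ i, Continuous (G i)
  hasPartialDerivAt : ∀ i x, HasPartialDerivAt i f (G i x) x

namespace HasGradient

variable {d : ℕ} {f f' : Torus d → Vec d} {G G' : Fin d → Torus d → Vec d}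

lemma add (h : HasGradient f G) (h' : HasGradient f' G') :
    HasGradient (f + f') (fun i => G i + G' i) where
  continuous := h.continuous.add h'.continuous
  continuous_grad i := (h.continuous_grad i).add (h'.continuous_grad i)
  hasPartialDerivAt i x := (h.hasPartialDerivAt i x).add (h'.hasPartialDerivAt i x)

lemma sub (h : HasGradient f G) (h' : HasGradient f' G') :
    HasGradient (f - f') (fun i => G i - G' i) where
  continuous := h.continuous.sub h'.continuous
  continuous_grad i := (h.continuous_grad i).sub (h'.continuous_grad i)
  hasPartialDerivAt i x := (h.hasPartialDerivAt i x).sub (h'.hasPartialDerivAt i x)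

lemma isWeakGradient (h : HasGradient f G) : IsWeakGradient f G where
  integrable := integrable_of_continuous h.continuous
  integrable_grad i := integrable_of_continuous (h.continuous_grad i)
  integral_eq φ hφ i := by
    have hzero := integral_smul_add_partialDeriv_smul hφ h.continuous (h.continuous_grad i)
      (h.hasPartialDerivAt i)
    have hφG : Integrable fun x => φ x • G i x :=
      integrable_of_continuous (hφ.continuous.smul (h.continuous_grad i))
    have hφf : Integrable fun x => partialDeriv i φ x • f x :=
      integrable_of_continuous ((hφ.continuous_partialDeriv i).smul h.continuous)
    rw [integral_add hφG hφf] at hzero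
    exact eq_neg_of_add_eq_zero_right hzero

lemma isDivergenceFree (h : HasGradient f G) (hdiv : ∀ x, ∑ i, G i x i = 0) :
    IsDivergenceFree f := by
  refine ⟨integrable_of_continuous h.continuous, fun φ hφ => ?_⟩
  have hf : ∀ i, Continuous fun x => f x i := fun i => by have := h.continuous; fun_prop
  have hG : ∀ i, Continuous fun x => G i x i := fun i => by have := h.continuous_grad i; fun_prop
  have hderiv : ∀ i x, HasPartialDerivAt i (fun x => f x i) (G i x i) x := fun i x =>
    (EuclideanSpace.proj i : Vec d →L[ℝ] ℝ).hasFDerivAt.comp_hasDerivAt 0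
      (h.hasPartialDerivAt i x)
  calc ∫ x, ∑ i, f x i * partialDeriv i φ x
      = ∫ x, ∑ i, (φ x • G i x i + partialDeriv i φ x • f x i) := by
        simp only [smul_eq_mul, Finset.sum_add_distrib, ← Finset.mul_sum, hdiv, mul_zero, zero_add,
          mul_comm]
    _ = ∑ i, ∫ x, (φ x • G i x i + partialDeriv i φ x • f x i) :=
        integral_finsetSum _ fun i _ => integrable_of_continuous
          ((hφ.continuous.smul (hG i)).add ((hφ.continuous_partialDeriv i).smul (hf i)))
    _ = 0 := Finset.sum_eq_zero fun i _ =>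
        integral_smul_add_partialDeriv_smul hφ (hf i) (hG i) (hderiv i)

lemma memW1p (h : HasGradient f G) (p : ℝ≥0∞) : MemW1p p f :=
  ⟨memLp_of_continuous h.continuous p, G, h.isWeakGradient,
    fun i => memLp_of_continuous (h.continuous_grad i) p⟩

lemma w1pNorm_le (h : HasGradient f G) (p : ℝ≥0∞) :
    w1pNorm p f ≤ eLpNorm f p + ∑ i, eLpNorm (G i) p :=
  add_le_add le_rfl (iInf₂_le G h.isWeakGradient)

end HasGradient

lemma isContinuousInW1p_of_hasGradient {d : ℕ} {p : ℝ≥0∞} {T : ℝ} {u : ℝ → Torus d → Vec d}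
    {G : ℝ → Fin d → Torus d → Vec d} (h : ∀ t, HasGradient (u t) (G t))
    (hu : ∀ t, Tendsto (fun s => eLpNorm (u s - u t) p) (𝓝 t) (𝓝 0))
    (hG : ∀ t i, Tendsto (fun s => eLpNorm (G s i - G t i) p) (𝓝 t) (𝓝 0)) :
    IsContinuousInW1p p T u := by
  refine fun t _ => ⟨(h t).memW1p p, Tendsto.mono_left ?_ nhdsWithin_le_nhds⟩
  have hlim : Tendsto (fun s => eLpNorm (u s - u t) p + ∑ i, eLpNorm (G s i - G t i) p)
      (𝓝 t) (𝓝 0) := by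
    simpa using (hu t).add (tendsto_finsetSum Finset.univ fun i _ => hG t i)
  exact tendsto_of_tendsto_of_tendsto_of_le_of_le tendsto_const_nhds hlim (fun _ => zero_le)
    fun s => ((h s).sub (h t)).w1pNorm_le p

lemma volume_forall_nsmul_sub_mem_le {d N : ℕ} (hN : N ≠ 0) (b : Torus d)
    {A : Fin d → Set UnitAddCircle} (hA : ∀ i, MeasurableSet (A i)) {c : ℝ≥0∞}
    (hc : ∀ i, volume (A i) ≤ c) :
    volume {x : Torus d | ∀ i, (N • (x - b)) i ∈ A i} ≤ c ^ d := by
  have hpi : {x : Torus d | ∀ i, (N • (x - b)) i ∈ A i} =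
      Set.pi univ fun i => (fun y : UnitAddCircle => N • (y - b i)) ⁻¹' A i := by
    ext x
    simp only [mem_ofPred_eq, mem_univ_pi, mem_preimage, Pi.smul_apply, Pi.sub_apply]
  have hvol : ∀ i, volume ((fun y : UnitAddCircle => N • (y - b i)) ⁻¹' A i) ≤ c := fun i => by
    have hmap : MeasurePreserving (fun y : UnitAddCircle => N • (y - b i)) := by
      have := (Measure.measurePreserving_zsmul (volume : Measure UnitAddCircle)
        (Int.natCast_ne_zero.2 hN)).comp (measurePreserving_sub_right volume (b i))
      simpa only [natCast_zsmul, Function.comp_def] using this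
    rw [hmap.measure_preimage (hA i).nullMeasurableSet]
    exact hc i
  rw [hpi, volume_pi_pi]
  exact (Finset.prod_le_pow_card _ _ c fun i _ => hvol i).trans_eq
    (by rw [Finset.card_univ, Fintype.card_fin])

/-! ### Scales, time steps and profiles -/

/-- The parameters of the construction: the time `T`, the factor `Q` by which the time intervals
shrink, and the exponent `ν` of the Cantor set. -/
structure Setup (d : ℕ) where
  T : ℝ
  Q : ℝ
  ν : ℝ
  T_pos : 0 < T
  one_lt_Q : 1 < Q
  ν_pos : 0 < ν
  two_le : 2 ≤ d

namespace Setup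

variable {d : ℕ} (P : Setup d)

/-- The ratio `2^{-(1+ν)}` of the Cantor set. -/
def κ : ℝ := (2 : ℝ) ^ (-(1 + P.ν))

lemma κ_pos : 0 < P.κ := Real.rpow_pos_of_pos two_pos _

lemma κ_lt : P.κ < 1 / 2 := by
  have : P.κ < (2 : ℝ) ^ (-1 : ℝ) :=
    Real.rpow_lt_rpow_of_exponent_lt one_lt_two (by linarith [P.ν_pos])
  rwa [Real.rpow_neg_one, ← one_div] at this

lemma cubeLength_eq (n : ℕ) : cubeLength P.ν n = P.κ ^ n := by
  rw [cubeLength, κ, ← Real.rpow_natCast, ← Real.rpow_mul two_pos.le, neg_mul]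

/-- In the unit of a cell of generation `n`, half the side length of the moving cubes of generation
`n + 1`, including a margin. The factor `κ ^ 5` makes these cubes so small that two copies of the
construction, shifted by `1 / 3`, do not interact. -/
def scale (n : ℕ) : ℝ := P.κ ^ 5 * (2 * P.κ) ^ n / 4

lemma scale_pos (n : ℕ) : 0 < P.scale n := by
  have := P.κ_pos
  unfold scale
  positivity

lemma scale_le (n : ℕ) : P.scale n ≤ 1 / 128 := by
  have h0 := P.κ_pos
  have h1 := P.κ_lt
  calc P.κ ^ 5 * (2 * P.κ) ^ n / 4 ≤ (1 / 2) ^ 5 * 1 / 4 := by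
        gcongr
        exact pow_le_one₀ (by linarith) (by linarith)
    _ = 1 / 128 := by norm_num

lemma scale_lt (n : ℕ) : P.scale n < 1 / 4 := (P.scale_le n).trans_lt (by norm_num)

lemma Q_pos : 0 < P.Q := one_pos.trans P.one_lt_Q

lemma Q_inv_lt_one : P.Q⁻¹ < 1 := inv_lt_one_of_one_lt₀ P.one_lt_Q

/-- A smooth step from `0` at time `T / Q` to `1` at time `T`. -/
def step (τ : ℝ) : ℝ := Real.smoothTransition ((τ / P.T - P.Q⁻¹) / (1 - P.Q⁻¹))

lemma contDiff_step : ContDiff ℝ ∞ P.step :=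
  Real.smoothTransition.contDiff.comp
    (((contDiff_id.div_const _).sub contDiff_const).div_const _)

lemma hasDerivAt_step (τ : ℝ) : HasDerivAt P.step (deriv P.step τ) τ :=
  (P.contDiff_step.differentiable (by simp) τ).hasDerivAt

lemma step_nonneg (τ : ℝ) : 0 ≤ P.step τ := Real.smoothTransition.nonneg _

lemma step_le_one (τ : ℝ) : P.step τ ≤ 1 := Real.smoothTransition.le_one _

lemma step_eq_zero {τ : ℝ} (h : P.Q * τ ≤ P.T) : P.step τ = 0 := by
  refine Real.smoothTransition.zero_of_nonpos (div_nonpos_of_nonpos_of_nonneg ?_ ?_)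
  · rwa [sub_nonpos, div_le_iff₀ P.T_pos, ← div_eq_inv_mul, le_div_iff₀' P.Q_pos]
  · exact sub_nonneg.2 P.Q_inv_lt_one.le

lemma step_eq_one {τ : ℝ} (h : P.T ≤ τ) : P.step τ = 1 := by
  refine Real.smoothTransition.one_of_one_le ?_
  rw [one_le_div (sub_pos.2 P.Q_inv_lt_one)]
  exact sub_le_sub_right ((one_le_div P.T_pos).2 h) _

lemma deriv_step_of_step_eq_zero {τ : ℝ} (h : P.step τ = 0) : deriv P.step τ = 0 :=
  IsLocalMin.deriv_eq_zero (.of_forall fun s => h.trans_le (P.step_nonneg s))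

lemma deriv_step_of_step_eq_one {τ : ℝ} (h : P.step τ = 1) : deriv P.step τ = 0 :=
  IsLocalMax.deriv_eq_zero (.of_forall fun s => (P.step_le_one s).trans_eq h.symm)

lemma lt_of_deriv_step_ne_zero {τ : ℝ} (h : deriv P.step τ ≠ 0) : P.T < P.Q * τ ∧ τ < P.T :=
  ⟨lt_of_not_ge fun hn => h (P.deriv_step_of_step_eq_zero (P.step_eq_zero hn)),
    lt_of_not_ge fun hn => h (P.deriv_step_of_step_eq_one (P.step_eq_one hn))⟩

lemma pos_of_deriv_step_ne_zero {τ : ℝ} (h : deriv P.step τ ≠ 0) : 0 < τ :=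
  pos_of_mul_pos_right (P.T_pos.trans (P.lt_of_deriv_step_ne_zero h).1) P.Q_pos.le

lemma contDiff_deriv_step : ContDiff ℝ ∞ (deriv P.step) :=
  (contDiff_infty_iff_deriv.1 P.contDiff_step).2

lemma hasCompactSupport_deriv_step : HasCompactSupport (deriv P.step) := by
  refine HasCompactSupport.intro (isCompact_Icc (a := 0) (b := P.T)) fun τ hτ => ?_
  by_contra h
  exact hτ ⟨(P.pos_of_deriv_step_ne_zero h).le, (P.lt_of_deriv_step_ne_zero h).2.le⟩

section

variable {P} {t : ℝ} {m m' : ℕ}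

lemma mul_pow_mul_le_of_lt (ht : 0 < P.Q ^ m * t) (hm : m < m') :
    P.Q * (P.Q ^ m * t) ≤ P.Q ^ m' * t := by
  have ht' : 0 < t := pos_of_mul_pos_right ht (pow_pos P.Q_pos m).le
  rw [← mul_assoc, ← pow_succ']
  gcongr
  · exact P.one_lt_Q.le
  · exact hm

lemma step_eq_one_of_lt (h : deriv P.step (P.Q ^ m * t) ≠ 0) (hm : m < m') :
    P.step (P.Q ^ m' * t) = 1 :=
  P.step_eq_one ((P.lt_of_deriv_step_ne_zero h).1.le.trans
    (mul_pow_mul_le_of_lt (P.pos_of_deriv_step_ne_zero h) hm))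

lemma step_eq_zero_of_gt (h : deriv P.step (P.Q ^ m * t) ≠ 0) (hm : m' < m) :
    P.step (P.Q ^ m' * t) = 0 := by
  have ht : 0 < t :=
    pos_of_mul_pos_right (P.pos_of_deriv_step_ne_zero h) (pow_pos P.Q_pos m).le
  exact P.step_eq_zero ((mul_pow_mul_le_of_lt (mul_pos (pow_pos P.Q_pos m') ht) hm).trans
    (P.lt_of_deriv_step_ne_zero h).2.le)

lemma deriv_step_eq_zero_of_ne (h : deriv P.step (P.Q ^ m * t) ≠ 0) (hm : m' ≠ m) :
    deriv P.step (P.Q ^ m' * t) = 0 := by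
  rcases lt_or_gt_of_ne hm with hlt | hgt
  · exact P.deriv_step_of_step_eq_zero (step_eq_zero_of_gt h hlt)
  · exact P.deriv_step_of_step_eq_one (step_eq_one_of_lt h hgt)

end

/-- A bump that is `1` in a neighborhood of `[-2κ, 2κ]`. -/
def η : ℝ → ℝ :=
  (⟨(1 + 2 * P.κ) / 2, (3 + 2 * P.κ) / 4, by linarith [P.κ_pos], by linarith [P.κ_lt]⟩ :
    ContDiffBump (0 : ℝ))

/-- A bump that is the identity in a neighborhood of `[-2κ, 2κ]`. -/
def ζ (y : ℝ) : ℝ := y * P.η y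

lemma isBump_η : IsBump P.η where
  smooth := ContDiffBump.contDiff _
  tsupport_subset := by
    have := P.κ_lt
    rw [η, ContDiffBump.tsupport_eq, Real.closedBall_eq_Icc]
    exact Icc_subset_Ioo (by linarith) (by linarith)

lemma isBump_ζ : IsBump P.ζ := P.isBump_η.id_mul

section

variable {P} {y : ℝ}

lemma η_eventuallyEq (hy : |y| ≤ 2 * P.κ) : P.η =ᶠ[𝓝 y] 1 := by
  refine ContDiffBump.eventuallyEq_one_of_mem_ball _ ?_
  rw [Metric.mem_ball, Real.dist_0_eq_abs]
  linarith [P.κ_lt]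

lemma η_eq_one (hy : |y| ≤ 2 * P.κ) : P.η y = 1 := (η_eventuallyEq hy).eq_of_nhds

lemma deriv_η_eq_zero (hy : |y| ≤ 2 * P.κ) : deriv P.η y = 0 :=
  (η_eventuallyEq hy).deriv_eq.trans (deriv_const y 1)

lemma deriv_ζ_eq_one (hy : |y| ≤ 2 * P.κ) : deriv P.ζ y = 1 := by
  have hζ : P.ζ =ᶠ[𝓝 y] id := by
    filter_upwards [η_eventuallyEq hy] with s hs
    rw [ζ, hs, Pi.one_apply, mul_one, id]
  rw [hζ.deriv_eq, deriv_id]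

end

/-- `M` bounds all functions of one variable that occur in the construction. Derivatives of the
profiles up to order two occur in the gradient of the velocity field. -/
structure IsBound (M : ℝ) : Prop where
  one_le : 1 ≤ M
  η : ∀ m ≤ 2, IsControlled M 1 (iteratedDeriv m P.η)
  ζ : ∀ m ≤ 2, IsControlled M 1 (iteratedDeriv m P.ζ)
  deriv_step : IsControlled M 1 (deriv P.step)

lemma exists_isBound : ∃ M, P.IsBound M :=
  ((eventually_ge_atTop 1).and ((P.isBump_η.eventually_forall_isControlled 2).and
    ((P.isBump_ζ.eventually_forall_isControlled 2).and (eventually_isControlled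
      P.contDiff_deriv_step P.hasCompactSupport_deriv_step)))).exists.imp
    fun _ h => ⟨h.1, h.2.1, h.2.2.1, h.2.2.2⟩

lemma IsBound.abs_step_sub_le {P : Setup d} {M : ℝ} (hM : P.IsBound M) (τ τ' : ℝ) :
    |P.step τ - P.step τ'| ≤ M * |τ - τ'| :=
  Convex.norm_image_sub_le_of_norm_deriv_le (s := univ)
    (fun s _ => P.contDiff_step.differentiable (by simp) s)
    (fun s _ => hM.deriv_step.norm_le s) convex_univ (mem_univ τ') (mem_univ τ)
end Setup

/-! ### Blocks -/

namespace Setup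

variable {d : ℕ} (P : Setup d)

/-- A coordinate different from `j`. A block moves cubes in direction `j` and returns in direction
`partner j`. -/
def partner (j : Fin d) : Fin d := ⟨if j.1 = 0 then 1 else 0, by have := P.two_le; split <;> omega⟩

lemma partner_ne (j : Fin d) : P.partner j ≠ j := by
  intro h
  have hval := congrArg Fin.val h
  simp only [partner] at hval
  split at hval <;> omega

/-- In a cell of generation `n`, the distance at time `t` between the `i`-th coordinates of the
center and of the moving cubes, in the unit of the cell. The coordinates move one after another,
and the finer generations move first. -/
def radius (n : ℕ) (i : Fin d) (t : ℝ) : ℝ :=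
  1 / 4 - (1 / 4 - P.scale n) * P.step (P.Q ^ (n * d + i) * t)

/-- The speed at which the cubes of generation `n + 1` move in direction `j`. -/
def speed (n : ℕ) (j : Fin d) (t : ℝ) : ℝ :=
  -((1 / 4 - P.scale n) * P.Q ^ (n * d + j) / 2 ^ n * deriv P.step (P.Q ^ (n * d + j) * t))

/-- The profile in the coordinate `i` of the stream function of a block that moves cubes in
direction `j`. -/
def profile (j i : Fin d) : ℝ → ℝ := if i = P.partner j then P.ζ else P.η

/-- The partial derivative of order `m` of the stream function of a block, up to a power of
`2 ^ n / scale n`. The stream function is a product of pairs of bumps, one bump for each of the two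
cubes that meet the cell in a line; it is odd in the coordinate `j` with respect to the center of a
cell, because the two cubes move in opposite directions. -/
def stream (b : Torus d) (n : ℕ) (j : Fin d) (m : Fin d → ℕ) (t : ℝ) (x : Torus d) : ℝ :=
  ∏ i, pairBump (iteratedDeriv (m i) (P.profile j i)) (if i = j then -1 else 1) (P.scale n)
    (P.radius n i t) (((2 ^ n : ℕ) • (x - b)) i)

/-- The partial derivative of order `m`, up to a power of `2 ^ n / scale n`, of the divergence-free
field that translates the cubes of generation `n + 1` in direction `j`. -/
def flow (b : Torus d) (n : ℕ) (j : Fin d) (m : Fin d → ℕ) (t : ℝ) (x : Torus d) : Vec d :=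
  P.speed n j t •
    (P.stream b n j (m + Pi.single (P.partner j) 1) t x • EuclideanSpace.single j (1 : ℝ) -
      P.stream b n j (m + Pi.single j 1) t x • EuclideanSpace.single (P.partner j) (1 : ℝ))

/-- The divergence-free field that translates the cubes of generation `n + 1` in direction `j`. -/
def block (b : Torus d) (n : ℕ) (j : Fin d) : ℝ → Torus d → Vec d := P.flow b n j 0

/-- The partial derivative of `block` in direction `i`. -/
def blockGrad (b : Torus d) (n : ℕ) (j i : Fin d) (t : ℝ) : Torus d → Vec d :=
  (2 ^ n / P.scale n) • P.flow b n j (Pi.single i 1) t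

lemma isBump_profile (j i : Fin d) : IsBump (P.profile j i) := by
  unfold profile
  split_ifs
  exacts [P.isBump_ζ, P.isBump_η]

lemma abs_ite_neg_one_one (p : Prop) [Decidable p] : |(if p then (-1 : ℝ) else 1)| = 1 := by
  split_ifs <;> simp

/-- A bound for the speed in the unit of the cells of generation `n`. -/
def rate (n : ℕ) : ℝ := P.Q ^ ((n + 1) * d)

lemma one_le_rate (n : ℕ) : 1 ≤ P.rate n := one_le_pow₀ P.one_lt_Q.le

lemma pow_le_rate (n : ℕ) (i : Fin d) : P.Q ^ (n * d + i) ≤ P.rate n :=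
  pow_le_pow_right₀ P.one_lt_Q.le (by rw [add_one_mul]; omega)

lemma nsmul_add_single_sub_apply (N : ℕ) (x b : Torus d) (i i' : Fin d) (s : ℝ) :
    (N • (x + Pi.single i (s : UnitAddCircle) - b : Torus d)) i' =
      if i' = i then (N • (x - b)) i' + ((N * s : ℝ) : UnitAddCircle) else (N • (x - b)) i' := by
  rw [← nsmul_eq_mul, AddCircle.coe_nsmul, add_sub_right_comm, nsmul_add, ← Pi.single_nsmul,
    Pi.add_apply, Pi.single_apply]
  split_ifs
  exacts [rfl, add_zero _]

lemma hasPartialDerivAt_stream (b : Torus d) (n : ℕ) (j : Fin d) (m : Fin d → ℕ) (t : ℝ)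
    (i : Fin d) (x : Torus d) :
    HasPartialDerivAt i (P.stream b n j m t)
      (2 ^ n / P.scale n * P.stream b n j (m + Pi.single i 1) t x) x := by
  have hfactor := ((P.isBump_profile j i).iteratedDeriv (m i)).hasDerivAt_pairBump_add
    (P.scale_pos n) (P.scale_lt n) (if i = j then -1 else 1) (P.radius n i t) ((2 ^ n : ℕ) : ℝ)
    (((2 ^ n : ℕ) • (x - b)) i)
  refine ((hfactor.mul_const (∏ i' ∈ Finset.univ.erase i,
    pairBump (iteratedDeriv (m i') (P.profile j i')) (if i' = j then -1 else 1) (P.scale n)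
      (P.radius n i' t) (((2 ^ n : ℕ) • (x - b)) i'))).congr_deriv ?_).congr_of_eventuallyEq
    (.of_forall fun s => ?_)
  · rw [stream, ← Finset.mul_prod_erase Finset.univ _ (Finset.mem_univ i), ← mul_assoc]
    congr 1
    · rw [Pi.add_apply, Pi.single_eq_same, iteratedDeriv_succ, Nat.cast_pow, Nat.cast_ofNat]
    · refine Finset.prod_congr rfl fun i' hi' => ?_
      rw [Pi.add_apply, Pi.single_eq_of_ne (Finset.ne_of_mem_erase hi'), add_zero]
  · simp only [stream]
    rw [← Finset.mul_prod_erase Finset.univ _ (Finset.mem_univ i),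
      nsmul_add_single_sub_apply, if_pos rfl]
    congr 1
    refine Finset.prod_congr rfl fun i' hi' => ?_
    rw [nsmul_add_single_sub_apply, if_neg (Finset.ne_of_mem_erase hi')]

lemma hasPartialDerivAt_block (b : Torus d) (n : ℕ) (j : Fin d) (t : ℝ) (i : Fin d)
    (x : Torus d) : HasPartialDerivAt i (P.block b n j t) (P.blockGrad b n j i t x) x := by
  have hj := (P.hasPartialDerivAt_stream b n j (0 + Pi.single (P.partner j) 1) t i x).smul_const
    (EuclideanSpace.single j 1 : Vec d)
  have hk := (P.hasPartialDerivAt_stream b n j (0 + Pi.single j 1) t i x).smul_const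
    (EuclideanSpace.single (P.partner j) 1 : Vec d)
  refine ((hj.sub hk).const_smul (P.speed n j t)).congr_deriv ?_
  simp only [blockGrad, flow, Pi.smul_apply, zero_add, add_comm (Pi.single i 1)]
  module

/-- The mixed second derivatives of the stream function commute. -/
lemma sum_blockGrad (b : Torus d) (n : ℕ) (j : Fin d) (t : ℝ) (x : Torus d) :
    ∑ i, P.blockGrad b n j i t x i = 0 := by
  simp only [blockGrad, flow, Pi.smul_apply, PiLp.smul_apply, PiLp.sub_apply, PiLp.single_apply,
    smul_eq_mul, mul_sub, mul_ite, mul_one, mul_zero, Finset.sum_sub_distrib,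
    Finset.sum_ite_eq', Finset.mem_univ, if_true]
  rw [add_comm (Pi.single j 1), sub_self]

variable {P} in
lemma flow_eq_zero {n : ℕ} {t : ℝ} {b x : Torus d} (i : Fin d)
    (hplus : P.scale n ≤
      ‖((2 ^ n : ℕ) • (x - b)) i - ((1 / 2 + P.radius n i t : ℝ) : UnitAddCircle)‖)
    (hminus : P.scale n ≤
      ‖((2 ^ n : ℕ) • (x - b)) i - ((1 / 2 - P.radius n i t : ℝ) : UnitAddCircle)‖)
    (j : Fin d) (m : Fin d → ℕ) : P.flow b n j m t x = 0 := by
  have hstream : ∀ m, P.stream b n j m t x = 0 := fun m =>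
    Finset.prod_eq_zero (Finset.mem_univ i)
      (((P.isBump_profile j i).iteratedDeriv (m i)).pairBump_eq_zero (P.scale_pos n) _ hplus hminus)
  rw [flow, hstream, hstream, zero_smul, zero_smul, sub_zero, smul_zero]

/-- The region, in generation `n`, of the moving cubes at time `t`. -/
def region (b : Torus d) (n : ℕ) (t : ℝ) : Set (Torus d) :=
  {x | ∀ i, ((2 ^ n : ℕ) • (x - b)) i ∈
    Metric.closedBall ((1 / 2 + P.radius n i t : ℝ) : UnitAddCircle) (P.scale n) ∪
    Metric.closedBall ((1 / 2 - P.radius n i t : ℝ) : UnitAddCircle) (P.scale n)}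

lemma volume_region_le (b : Torus d) (n : ℕ) (t : ℝ) :
    volume (P.region b n t) ≤ ENNReal.ofReal (4 * P.scale n) ^ d :=
  volume_forall_nsmul_sub_mem_le (by positivity) b
    (fun _ => Metric.isClosed_closedBall.measurableSet.union
      Metric.isClosed_closedBall.measurableSet)
    fun _ => volume_union_closedBall_le (P.scale_pos n).le _ _

lemma support_flow_subset (b : Torus d) (n : ℕ) (j : Fin d) (m : Fin d → ℕ) (t : ℝ) :
    Function.support (P.flow b n j m t) ⊆ P.region b n t := by
  intro x hx
  by_contra hn
  simp only [region, mem_ofPred_eq, not_forall, mem_union, not_or, Metric.mem_closedBall, not_le,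
    dist_eq_norm] at hn
  obtain ⟨i, hplus, hminus⟩ := hn
  exact hx (flow_eq_zero i hplus.le hminus.le j m)

/-- The constant in the amplitude of the blocks. -/
def ampConst (d : ℕ) (M : ℝ) : ℝ := M * ((2 * M) ^ d + (2 * M) ^ d)

/-- The constant in the Lipschitz rate of the blocks. -/
def rateConst (d : ℕ) (M : ℝ) : ℝ := 1 + d * (1 + M)

lemma single_one_le_one (i : Fin d) : (Pi.single i 1 : Fin d → ℕ) ≤ 1 := fun i' => by
  rw [Pi.single_apply]
  split_ifs
  exacts [le_rfl, zero_le_one]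

namespace IsBound

variable {P} {M : ℝ}

lemma profile (hM : P.IsBound M) (j i : Fin d) :
    ∀ m ≤ 2, IsControlled M 1 (iteratedDeriv m (P.profile j i)) := by
  unfold Setup.profile
  split_ifs
  exacts [hM.ζ, hM.η]

lemma abs_radius_sub_le (hM : P.IsBound M) (n : ℕ) (i : Fin d) (t t' : ℝ) :
    |P.radius n i t - P.radius n i t'| ≤ M * P.rate n * |t - t'| := by
  have hM1 := hM.one_le
  have hs := P.scale_pos n
  have hs' := P.scale_lt n
  have hQ := pow_pos P.Q_pos (n * d + i)
  calc |P.radius n i t - P.radius n i t'|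
      = (1 / 4 - P.scale n) *
          |P.step (P.Q ^ (n * d + i) * t) - P.step (P.Q ^ (n * d + i) * t')| := by
        rw [radius, radius, sub_sub_sub_cancel_left, ← mul_sub, abs_mul, abs_sub_comm (P.step _),
          abs_of_pos (by linarith)]
    _ ≤ 1 * (M * |P.Q ^ (n * d + i) * t - P.Q ^ (n * d + i) * t'|) := by
        gcongr
        · linarith
        · exact hM.abs_step_sub_le _ _
    _ = M * P.Q ^ (n * d + i) * |t - t'| := by
        rw [← mul_sub, abs_mul, abs_of_pos hQ, one_mul, mul_assoc]
    _ ≤ M * P.rate n * |t - t'| := by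
        gcongr
        exact P.pow_le_rate n i

lemma isControlled_speed (hM : P.IsBound M) (n : ℕ) (j : Fin d) :
    IsControlled (M * (P.rate n / 2 ^ n)) (P.rate n) (P.speed n j) := by
  have hM1 := hM.one_le
  have hs := P.scale_pos n
  have hs' := P.scale_lt n
  have hQ := pow_pos P.Q_pos (n * d + j)
  have hfactor : 0 ≤ (1 / 4 - P.scale n) * P.Q ^ (n * d + j) / 2 ^ n :=
    div_nonneg (mul_nonneg (by linarith) hQ.le) (by positivity)
  have hstep : IsControlled M (1 * P.Q ^ (n * d + j))
      fun t => deriv P.step (P.Q ^ (n * d + j) * t) :=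
    hM.deriv_step.comp hQ.le fun t t' => by
      rw [Real.dist_eq, ← mul_sub, abs_mul, abs_of_pos hQ, Real.dist_eq]
  refine (hstep.const_smul ((1 / 4 - P.scale n) * P.Q ^ (n * d + j) / 2 ^ n)).neg.mono ?_ ?_
  · rw [Real.norm_of_nonneg hfactor, mul_comm M]
    gcongr
    calc (1 / 4 - P.scale n) * P.Q ^ (n * d + j) ≤ 1 * P.rate n := by
          gcongr
          · linarith
          · exact P.pow_le_rate n j
      _ = P.rate n := one_mul _
  · rw [one_mul]
    exact P.pow_le_rate n j

lemma isControlled_stream (hM : P.IsBound M) (b : Torus d) (n : ℕ) (j : Fin d)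
    {m : Fin d → ℕ} (hm : m ≤ 2) :
    IsControlled ((2 * M) ^ d) (d * ((2 ^ n + M * P.rate n) / P.scale n))
      fun z : ℝ × Torus d => P.stream b n j m z.1 z.2 := by
  have hM1 := hM.one_le
  have hR := P.one_le_rate n
  have hprod := IsControlled.prod Finset.univ fun i =>
    ((P.isBump_profile j i).iteratedDeriv (m i)).isControlled_pairBump
      (hM.profile j i (m i) (hm i)) (abs_ite_neg_one_one (i = j)) (P.scale_pos n) (P.scale_lt n)
      (r := fun z : ℝ × Torus d => P.radius n i z.1) (ξ := fun z => ((2 ^ n : ℕ) • (z.2 - b)) i)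
      (Kr := M * P.rate n) (Kξ := 2 ^ n) (by positivity) (by positivity) (fun z z' => ?_)
      (fun z z' => ?_)
  · simpa only [Finset.card_univ, Fintype.card_fin, stream] using hprod
  · exact (hM.abs_radius_sub_le n i _ _).trans (by gcongr; exact le_max_left _ _)
  · calc dist (((2 ^ n : ℕ) • (z.2 - b)) i) (((2 ^ n : ℕ) • (z'.2 - b)) i)
        ≤ ‖(2 ^ n : ℕ) • (z.2 - z'.2)‖ := by
          rw [dist_eq_norm, ← sub_sub_sub_cancel_right z.2 z'.2 b, nsmul_sub (z.2 - b)]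
          exact norm_le_pi_norm ((2 ^ n : ℕ) • (z.2 - b) - (2 ^ n : ℕ) • (z'.2 - b)) i
      _ ≤ (2 ^ n : ℕ) * ‖z.2 - z'.2‖ := norm_nsmul_le
      _ ≤ 2 ^ n * dist z z' := by
          rw [← dist_eq_norm, Nat.cast_pow, Nat.cast_ofNat]
          gcongr
          exact le_max_right _ _

lemma add_mul_rate_le (hM : P.IsBound M) (n : ℕ) :
    P.rate n + d * ((2 ^ n + M * P.rate n) / P.scale n) ≤
      rateConst d M * (2 ^ n * P.rate n / P.scale n) := by
  have hM1 := hM.one_le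
  have hR := P.one_le_rate n
  have hs := P.scale_pos n
  have hN : (1 : ℝ) ≤ 2 ^ n := one_le_pow₀ one_le_two
  have hrate : P.rate n ≤ 2 ^ n * P.rate n / P.scale n := by
    rw [le_div_iff₀ hs]
    nlinarith [P.scale_le n]
  have hsum : 2 ^ n + M * P.rate n ≤ (1 + M) * (2 ^ n * P.rate n) := by
    rw [one_add_mul]
    exact add_le_add (le_mul_of_one_le_right (by positivity) hR)
      (by gcongr; exact le_mul_of_one_le_left (by positivity) hN)
  calc P.rate n + d * ((2 ^ n + M * P.rate n) / P.scale n)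
      ≤ 2 ^ n * P.rate n / P.scale n + d * ((1 + M) * (2 ^ n * P.rate n) / P.scale n) := by gcongr
    _ = rateConst d M * (2 ^ n * P.rate n / P.scale n) := by rw [rateConst]; ring

lemma isControlled_flow (hM : P.IsBound M) (b : Torus d) (n : ℕ) (j : Fin d)
    {m : Fin d → ℕ} (hm : m ≤ 1) :
    IsControlled (ampConst d M * (P.rate n / 2 ^ n))
      (rateConst d M * (2 ^ n * P.rate n / P.scale n))
      fun z : ℝ × Torus d => P.flow b n j m z.1 z.2 := by
  have hspeed : IsControlled (M * (P.rate n / 2 ^ n)) (P.rate n * 1)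
      fun z : ℝ × Torus d => P.speed n j z.1 :=
    (hM.isControlled_speed n j).comp zero_le_one fun z z' => by
      rw [one_mul]
      exact le_max_left _ _
  have hstream := fun i k : Fin d => (hM.isControlled_stream b n j
    ((add_le_add hm (single_one_le_one i)).trans_eq one_add_one_eq_two)).smul_const
      (EuclideanSpace.single k 1 : Vec d)
  refine (hspeed.smul ((hstream (P.partner j) j).sub (hstream j (P.partner j)))).mono
    (le_of_eq ?_) ((hM.add_mul_rate_le n).trans' (by rw [mul_one]))
  rw [PiLp.norm_single, PiLp.norm_single, norm_one, mul_one, ampConst]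
  ring

lemma isControlled_block (hM : P.IsBound M) (b : Torus d) (n : ℕ) (j : Fin d) :
    IsControlled (ampConst d M * (P.rate n / 2 ^ n))
      (rateConst d M * (2 ^ n * P.rate n / P.scale n))
      fun z : ℝ × Torus d => P.block b n j z.1 z.2 :=
  hM.isControlled_flow b n j zero_le_one

lemma isControlled_blockGrad (hM : P.IsBound M) (b : Torus d) (n : ℕ) (j i : Fin d) :
    IsControlled (ampConst d M * (P.rate n / P.scale n))
      (rateConst d M * (2 ^ n * P.rate n / P.scale n))
      fun z : ℝ × Torus d => P.blockGrad b n j i z.1 z.2 := by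
  have hs := P.scale_pos n
  refine ((hM.isControlled_flow b n j (single_one_le_one i)).const_smul
    (2 ^ n / P.scale n)).mono (le_of_eq ?_) le_rfl
  rw [Real.norm_of_nonneg (by positivity)]
  field_simp

lemma hasGradient_block (hM : P.IsBound M) (b : Torus d) (n : ℕ) (j : Fin d) (t : ℝ) :
    HasGradient (P.block b n j t) (fun i => P.blockGrad b n j i t) where
  continuous := (hM.isControlled_block b n j).continuous.comp (Continuous.prodMk_right t)
  continuous_grad i := (hM.isControlled_blockGrad b n j i).continuous.comp
    (Continuous.prodMk_right t)
  hasPartialDerivAt i x := P.hasPartialDerivAt_block b n j t i x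

lemma eLpNorm_blockGrad_le (hM : P.IsBound M) (b : Torus d) (n : ℕ) (j i : Fin d) (t : ℝ)
    {p : ℝ} (hp : 0 ≤ p) :
    eLpNorm (P.blockGrad b n j i t) (ENNReal.ofReal p) ≤
      ENNReal.ofReal ((4 * P.scale n) ^ (d / p) * (ampConst d M * (P.rate n / P.scale n))) := by
  have hs := P.scale_pos n
  have hsupp : Function.support (P.blockGrad b n j i t) ⊆ P.region b n t :=
    (Function.support_const_smul_subset _ _).trans (P.support_flow_subset b n j _ t)
  have hvol : volume (P.region b n t) ^ p⁻¹ ≤ ENNReal.ofReal ((4 * P.scale n) ^ (d / p)) :=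
    calc volume (P.region b n t) ^ p⁻¹ ≤ (ENNReal.ofReal (4 * P.scale n) ^ d) ^ p⁻¹ := by
          gcongr
          exact P.volume_region_le b n t
      _ = ENNReal.ofReal ((4 * P.scale n) ^ (d / p)) := by
          rw [← ENNReal.rpow_natCast, ← ENNReal.rpow_mul, ← div_eq_mul_inv,
            ENNReal.ofReal_rpow_of_pos (by positivity)]
  rw [ENNReal.ofReal_mul (by positivity)]
  refine (eLpNorm_le_of_support_subset
    (fun x => (hM.isControlled_blockGrad b n j i).norm_le (t, x)) hsupp _).trans ?_
  rw [ENNReal.toReal_ofReal hp]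
  gcongr

end IsBound

end Setup

/-! ### The velocity field -/

lemma IsControlled.tendsto_eLpNorm_sub {X E : Type*} [PseudoMetricSpace X] [MeasurableSpace X]
    [NormedAddCommGroup E] {μ : Measure X} [IsFiniteMeasure μ] {A R : ℝ} {V : ℝ → X → E}
    (h : IsControlled A R fun z : ℝ × X => V z.1 z.2) (p : ℝ≥0∞) (t : ℝ) :
    Tendsto (fun s => eLpNorm (V s - V t) p μ) (𝓝 t) (𝓝 0) := by
  have hlim : Tendsto (fun s => μ univ ^ p.toReal⁻¹ * ENNReal.ofReal (A * R * dist s t))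
      (𝓝 t) (𝓝 0) := by
    have hcont : Continuous fun s => ENNReal.ofReal (A * R * dist s t) :=
      ENNReal.continuous_ofReal.comp (by fun_prop)
    simpa using ENNReal.Tendsto.const_mul (hcont.tendsto t) (.inr (ENNReal.rpow_ne_top_of_nonneg
      (inv_nonneg.2 ENNReal.toReal_nonneg) (measure_ne_top μ univ)))
  refine tendsto_of_tendsto_of_tendsto_of_le_of_le tendsto_const_nhds hlim (fun _ => zero_le)
    fun s => eLpNorm_le_of_ae_bound (.of_forall fun x => ?_)
  simpa only [Pi.sub_apply, dist_prod_same_right] using h.norm_sub_le (s, x) (t, x)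

lemma holderWith_of_dist_le {X Y : Type*} [PseudoMetricSpace X] [PseudoMetricSpace Y] {f : X → Y}
    {K α : ℝ} (h0 : 0 ≤ α) (h : ∀ x y, dist (f x) (f y) ≤ K * dist x y ^ α) :
    HolderWith K.toNNReal α.toNNReal f := by
  intro x y
  rw [edist_dist, edist_dist, Real.coe_toNNReal α h0,
    ENNReal.ofReal_rpow_of_nonneg dist_nonneg h0, ENNReal.ofNNReal_toNNReal,
    ← ENNReal.ofReal_mul' (by positivity)]
  exact ENNReal.ofReal_le_ofReal (h x y)

namespace Setup

variable {d : ℕ} (P : Setup d)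

/-- The sum of all blocks, with the origin of the dyadic cells at `b`. -/
def field (b : Torus d) (t : ℝ) : Torus d → Vec d := ∑' m : ℕ × Fin d, P.block b m.1 m.2 t

/-- The partial derivative of `field` in direction `i`. -/
def fieldGrad (b : Torus d) (t : ℝ) (i : Fin d) : Torus d → Vec d :=
  ∑' m : ℕ × Fin d, P.blockGrad b m.1 m.2 i t

lemma index_injective : Function.Injective fun m : ℕ × Fin d => m.1 * d + (m.2 : ℕ) := by
  intro m m' h
  have hmod := congrArg (· % d) h
  simp only [Nat.mul_add_mod_self_right, Nat.mod_eq_of_lt m.2.2, Nat.mod_eq_of_lt m'.2.2] at hmod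
  exact Prod.ext (Nat.eq_of_mul_eq_mul_right m.2.pos (by dsimp only at h; omega)) (Fin.ext hmod)

lemma exists_speed_eq_zero (t : ℝ) : ∃ m : ℕ × Fin d, ∀ m' ≠ m, P.speed m'.1 m'.2 t = 0 := by
  suffices ∃ m : ℕ × Fin d, ∀ m' ≠ m, deriv P.step (P.Q ^ (m'.1 * d + m'.2) * t) = 0 by
    obtain ⟨m, hm⟩ := this
    exact ⟨m, fun m' hne => by rw [speed, hm m' hne, mul_zero, neg_zero]⟩
  by_cases h : ∃ m : ℕ × Fin d, deriv P.step (P.Q ^ (m.1 * d + m.2) * t) ≠ 0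
  · obtain ⟨m, hm⟩ := h
    exact ⟨m, fun m' hne => deriv_step_eq_zero_of_ne hm (index_injective.ne hne)⟩
  · push Not at h
    exact ⟨(0, ⟨0, by linarith [P.two_le]⟩), fun m' _ => h m'⟩

lemma flow_eq_zero_of_speed_eq_zero {P : Setup d} {n : ℕ} {j : Fin d} {t : ℝ}
    (h : P.speed n j t = 0) (b : Torus d) (m : Fin d → ℕ) : P.flow b n j m t = 0 := by
  funext x
  rw [flow, h, zero_smul, Pi.zero_apply]

lemma exists_flow_eq_zero (t : ℝ) : ∃ m : ℕ × Fin d, ∀ m' ≠ m, ∀ (b : Torus d) (k : Fin d → ℕ),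
    P.flow b m'.1 m'.2 k t = 0 := by
  obtain ⟨m, hm⟩ := P.exists_speed_eq_zero t
  exact ⟨m, fun m' hne => flow_eq_zero_of_speed_eq_zero (hm m' hne)⟩

lemma exists_block_eq_zero (b : Torus d) (t : ℝ) :
    ∃ m : ℕ × Fin d, ∀ m' ≠ m, P.block b m'.1 m'.2 t = 0 :=
  (P.exists_flow_eq_zero t).imp fun _ hm m' hne => hm m' hne b 0

lemma exists_blockGrad_eq_zero (b : Torus d) (i : Fin d) (t : ℝ) :
    ∃ m : ℕ × Fin d, ∀ m' ≠ m, P.blockGrad b m'.1 m'.2 i t = 0 :=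
  (P.exists_flow_eq_zero t).imp fun _ hm m' hne => by rw [blockGrad, hm m' hne, smul_zero]

lemma exists_field_eq (b : Torus d) (t : ℝ) :
    ∃ m : ℕ × Fin d, P.field b t = P.block b m.1 m.2 t ∧
      P.fieldGrad b t = fun i => P.blockGrad b m.1 m.2 i t := by
  obtain ⟨m, hm⟩ := P.exists_flow_eq_zero t
  refine ⟨m, tsum_eq_single m fun m' hne => hm m' hne b 0, funext fun i =>
    tsum_eq_single m fun m' hne => ?_⟩
  rw [blockGrad, hm m' hne, smul_zero]

lemma hasGradient_field (b : Torus d) (t : ℝ) : HasGradient (P.field b t) (P.fieldGrad b t) := by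
  obtain ⟨M, hM⟩ := P.exists_isBound
  obtain ⟨m, hfield, hgrad⟩ := P.exists_field_eq b t
  rw [hfield, hgrad]
  exact hM.hasGradient_block b m.1 m.2 t

lemma sum_fieldGrad (b : Torus d) (t : ℝ) (x : Torus d) : ∑ i, P.fieldGrad b t i x i = 0 := by
  obtain ⟨m, -, hgrad⟩ := P.exists_field_eq b t
  rw [hgrad]
  exact P.sum_blockGrad b m.1 m.2 t x

lemma tendsto_fst_cofinite {ι : Type*} [Finite ι] :
    Tendsto (Prod.fst : ℕ × ι → ℕ) cofinite atTop := by
  rw [← Nat.cofinite_eq_atTop, ← coprod_cofinite, cofinite_eq_bot (α := ι), coprod_bot]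
  exact tendsto_comap

lemma eventually_eLpNorm_le {ι X E : Type*} [Finite ι] [MeasurableSpace X] [NormedAddCommGroup E]
    {μ : Measure X} {p : ℝ≥0∞} {V : ℕ × ι → ℝ → X → E} {f : ℕ → ℝ}
    (hf : Tendsto f atTop (𝓝 0)) (hV : ∀ m t, eLpNorm (V m t) p μ ≤ ENNReal.ofReal (f m.1))
    (ε : ℝ≥0∞) (hε : 0 < ε) : ∀ᶠ m in cofinite, ∀ t, eLpNorm (V m t) p μ ≤ ε := by
  have hlim : Tendsto (fun n => ENNReal.ofReal (f n)) atTop (𝓝 0) := by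
    simpa using ENNReal.tendsto_ofReal hf
  filter_upwards [ENNReal.tendsto_nhds_zero.1 (hlim.comp tendsto_fst_cofinite) ε hε] with m hm t
  exact (hV m t).trans hm

lemma tendsto_eLpNorm_field_sub {p : ℝ≥0∞} (hp : 1 ≤ p)
    (h : Tendsto (fun n => P.rate n / 2 ^ n) atTop (𝓝 0)) (b : Torus d) (t : ℝ) :
    Tendsto (fun s => eLpNorm (P.field b s - P.field b t) p) (𝓝 t) (𝓝 0) := by
  obtain ⟨M, hM⟩ := P.exists_isBound
  refine tendsto_eLpNorm_tsum_sub (V := fun m : ℕ × Fin d => P.block b m.1 m.2) hp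
    (fun m t => (integrable_of_continuous
      (hM.hasGradient_block b m.1 m.2 t).continuous).aestronglyMeasurable)
    (P.exists_block_eq_zero b)
    (eventually_eLpNorm_le (f := fun n => ampConst d M * (P.rate n / 2 ^ n))
      (by simpa using h.const_mul (ampConst d M)) fun m t => ?_)
    (fun m t => (hM.isControlled_block b m.1 m.2).tendsto_eLpNorm_sub p t) t
  refine (eLpNorm_le_of_ae_bound
    (.of_forall fun x => (hM.isControlled_block b m.1 m.2).norm_le (t, x))).trans_eq ?_
  rw [volume_pi, Measure.pi_univ]
  simp

lemma tendsto_eLpNorm_fieldGrad_sub {p : ℝ} (hp : 1 ≤ p)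
    (h : Tendsto (fun n => P.rate n * P.scale n ^ (d / p - 1)) atTop (𝓝 0)) (b : Torus d)
    (i : Fin d) (t : ℝ) :
    Tendsto (fun s => eLpNorm (P.fieldGrad b s i - P.fieldGrad b t i) (ENNReal.ofReal p))
      (𝓝 t) (𝓝 0) := by
  obtain ⟨M, hM⟩ := P.exists_isBound
  refine tendsto_eLpNorm_tsum_sub (V := fun m : ℕ × Fin d => P.blockGrad b m.1 m.2 i)
    (ENNReal.one_le_ofReal.2 hp)
    (fun m t => (integrable_of_continuous
      ((hM.hasGradient_block b m.1 m.2 t).continuous_grad i)).aestronglyMeasurable)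
    (P.exists_blockGrad_eq_zero b i)
    (eventually_eLpNorm_le
      (f := fun n => (4 : ℝ) ^ (d / p) * ampConst d M * (P.rate n * P.scale n ^ (d / p - 1)))
      (by simpa using h.const_mul ((4 : ℝ) ^ (d / p) * ampConst d M)) fun m t => ?_)
    (fun m t => (hM.isControlled_blockGrad b m.1 m.2 i).tendsto_eLpNorm_sub _ t) t
  have hs := P.scale_pos m.1
  refine (hM.eLpNorm_blockGrad_le b m.1 m.2 i t (by linarith)).trans_eq (congrArg _ ?_)
  rw [Real.mul_rpow (by norm_num) hs.le, Real.rpow_sub_one hs.ne']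
  ring

lemma field_apply (b : Torus d) (t : ℝ) (x : Torus d) :
    P.field b t x = ∑' m : ℕ × Fin d, P.block b m.1 m.2 t x := by
  obtain ⟨m, hm⟩ := P.exists_block_eq_zero b t
  rw [field, tsum_eq_single m hm]
  exact (tsum_eq_single m fun m' hne => congrFun (hm m' hne) x).symm

lemma IsBound.norm_block_sub_le {P : Setup d} {M : ℝ} (hM : P.IsBound M) {α : ℝ} (h0 : 0 ≤ α)
    (h1 : α ≤ 1) {C : ℝ} (hC : ∀ n, P.rate n / 2 ^ n * (2 ^ n * P.rate n / P.scale n) ^ α ≤ C)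
    (b : Torus d) (n : ℕ) (j : Fin d) (z z' : ℝ × Torus d) :
    ‖P.block b n j z.1 z.2 - P.block b n j z'.1 z'.2‖ ≤
      2 * (ampConst d M * rateConst d M ^ α * C) * dist z z' ^ α := by
  have hM1 := hM.one_le
  have hs := P.scale_pos n
  have hR := P.one_le_rate n
  have hA : 0 ≤ ampConst d M := by unfold ampConst; positivity
  have hL : 0 ≤ rateConst d M := by unfold rateConst; positivity
  refine ((hM.isControlled_block b n j).norm_sub_le_rpow h0 h1 z z').trans ?_
  rw [Real.mul_rpow hL (by positivity), mul_mul_mul_comm]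
  gcongr
  exact hC n

lemma exists_holderWith_field {α : ℝ} (h0 : 0 ≤ α) (h1 : α ≤ 1) {C : ℝ}
    (hC : ∀ n, P.rate n / 2 ^ n * (2 ^ n * P.rate n / P.scale n) ^ α ≤ C) (b : Torus d) :
    ∃ K, HolderWith K α.toNNReal fun z : ℝ × Torus d => P.field b z.1 z.2 := by
  obtain ⟨M, hM⟩ := P.exists_isBound
  set K := 2 * (ampConst d M * rateConst d M ^ α * C)
  refine ⟨(2 * K).toNNReal, holderWith_of_dist_le h0 fun z z' => ?_⟩
  obtain ⟨F, hF, hsum⟩ := exists_finset_tsum_sub_tsum_eq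
    (V := fun (m : ℕ × Fin d) (z : ℝ × Torus d) => P.block b m.1 m.2 z.1 z.2)
    (fun z => (P.exists_block_eq_zero b z.1).imp fun _ hm m' hne => congrFun (hm m' hne) z.2) z z'
  rw [dist_eq_norm, field_apply, field_apply, hsum]
  have hK : 0 ≤ K * dist z z' ^ α :=
    (norm_nonneg _).trans (hM.norm_block_sub_le h0 h1 hC b 0 ⟨0, by linarith [P.two_le]⟩ z z')
  calc ‖∑ m ∈ F, (P.block b m.1 m.2 z.1 z.2 - P.block b m.1 m.2 z'.1 z'.2)‖
      ≤ F.card • (K * dist z z' ^ α) :=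
        (norm_sum_le _ _).trans (F.sum_le_card_nsmul _ _ fun m _ =>
          hM.norm_block_sub_le h0 h1 hC b m.1 m.2 z z')
    _ ≤ 2 • (K * dist z z' ^ α) := nsmul_le_nsmul_left hK hF
    _ = 2 * K * dist z z' ^ α := by rw [nsmul_eq_mul, Nat.cast_ofNat, ← mul_assoc]

end Setup

/-! ### Binary digits and trajectories -/

/-- The center of the dyadic interval of generation `n` that contains `y`. -/
def cellCenter (n : ℕ) (y : ℝ) : ℝ := (⌊2 ^ n * y⌋ + 1 / 2) / 2 ^ n

/-- The binary digits of `y`: the digit is `1` in the upper and `-1` in the lower half of the dyadic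
interval of generation `n`. -/
def digit (n : ℕ) (y : ℝ) : ℤˣ := if Odd ⌊2 ^ (n + 1) * y⌋ then 1 else -1

lemma cellCenter_succ (n : ℕ) (y : ℝ) :
    cellCenter (n + 1) y = cellCenter n y + (digit n y : ℤ) / (4 * 2 ^ n) := by
  have hfloor : ⌊2 ^ n * y⌋ = ⌊2 ^ (n + 1) * y⌋ / 2 := by
    have h := Int.natCast_mul_floor_div_cancel (n := 2) two_ne_zero (2 ^ n * y)
    rwa [Nat.cast_ofNat, Nat.cast_ofNat, ← mul_assoc, ← pow_succ', eq_comm] at h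
  rw [cellCenter, cellCenter, digit, hfloor, pow_succ (2 : ℝ) n]
  split_ifs with h
  · obtain ⟨k, hk⟩ := h
    rw [hk, show (2 * k + 1) / 2 = k by omega]
    push_cast
    field_simp
    ring
  · obtain ⟨k, hk⟩ := Int.not_odd_iff_even.1 h
    rw [hk, show (k + k) / 2 = k by omega]
    push_cast
    field_simp
    ring

lemma abs_cellCenter_sub_le (n : ℕ) (y : ℝ) : |cellCenter n y - y| ≤ (1 / 2) ^ n := by
  have hpow : (0 : ℝ) < 2 ^ n := by positivity
  have e : cellCenter n y - y = (⌊2 ^ n * y⌋ + 1 / 2 - 2 ^ n * y) / 2 ^ n := by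
    rw [cellCenter, sub_div, mul_div_cancel_left₀ _ hpow.ne']
  rw [e, abs_div, abs_of_pos hpow, one_div_pow]
  gcongr
  rw [abs_le]
  constructor <;> linarith [Int.floor_le (2 ^ n * y), Int.lt_floor_add_one (2 ^ n * y)]

lemma abs_units_coe (s : ℤˣ) : |((s : ℤ) : ℝ)| = 1 := by
  rcases Int.units_eq_one_or s with rfl | rfl <;> simp

section

variable {k : ℝ} (h0 : 0 ≤ k) (s : ℕ → ℤˣ)

include h0

lemma norm_units_mul_pow (i : ℕ) : ‖((s i : ℤ) * k ^ i : ℝ)‖ = k ^ i := by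
  rw [norm_mul, Real.norm_eq_abs, abs_units_coe, one_mul, Real.norm_of_nonneg (by positivity)]

lemma summable_units_mul_pow (h1 : k < 1) : Summable fun i => ((s i : ℤ) * k ^ i : ℝ) :=
  .of_norm_bounded (summable_geometric_of_lt_one h0 h1) fun i => (norm_units_mul_pow h0 s i).le

lemma abs_tsum_units_mul_pow_le (h1 : k < 1) : |∑' i, ((s i : ℤ) * k ^ i : ℝ)| ≤ (1 - k)⁻¹ :=
  tsum_of_norm_bounded (hasSum_geometric_of_lt_one h0 h1) fun i => (norm_units_mul_pow h0 s i).le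

end

namespace Setup

variable {d : ℕ} (P : Setup d)

lemma κ_lt_one : P.κ < 1 := P.κ_lt.trans one_half_lt_one

lemma abs_tsum_units_mul_κ_pow_le (s : ℕ → ℤˣ) : |∑' i, ((s i : ℤ) * P.κ ^ i : ℝ)| ≤ 2 := by
  have h := P.κ_lt
  refine (abs_tsum_units_mul_pow_le P.κ_pos.le s P.κ_lt_one).trans ?_
  rw [inv_le_comm₀ (by linarith) two_pos]
  linarith

/-- The position in the Cantor set, relative to a cube, that is encoded by the digits of `y` from
the `n`-th on. -/
def tail (n : ℕ) (y : ℝ) : ℝ := ∑' i, (digit (n + i) y : ℤ) * P.κ ^ i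

lemma tail_succ (n : ℕ) (y : ℝ) : P.tail n y = (digit n y : ℤ) + P.κ * P.tail (n + 1) y := by
  rw [tail, tail,
    (summable_units_mul_pow P.κ_pos.le (fun i => digit (n + i) y) P.κ_lt_one).tsum_eq_zero_add,
    ← tsum_mul_left, add_zero, pow_zero, mul_one]
  congr 2
  funext i
  rw [add_right_comm, add_assoc, pow_succ]
  ring

lemma abs_tail_le (n : ℕ) (y : ℝ) : |P.tail n y| ≤ 2 := P.abs_tsum_units_mul_κ_pow_le _

lemma abs_κ_mul_tail_le (n : ℕ) (y : ℝ) : |P.κ * P.tail n y| ≤ 2 * P.κ := by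
  rw [abs_mul, abs_of_pos P.κ_pos, mul_comm]
  exact mul_le_mul_of_nonneg_right (P.abs_tail_le n y) P.κ_pos.le

lemma scale_succ (n : ℕ) : P.scale (n + 1) = 2 * P.κ * P.scale n := by
  rw [scale, scale, pow_succ]
  ring

/-- The position at which the coordinate with initial value `y` rests between the motions of the
generations `n + 1` and `n`. -/
def rest (n : ℕ) (y : ℝ) : ℝ := cellCenter n y + P.scale n * P.tail n y / 2 ^ n

lemma rest_succ (n : ℕ) (y : ℝ) :
    P.rest (n + 1) y =
      cellCenter n y + ((digit n y : ℤ) / 4 + P.scale n * (P.κ * P.tail (n + 1) y)) / 2 ^ n := by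
  rw [rest, cellCenter_succ, scale_succ, pow_succ]
  field_simp
  ring

lemma rest_sub_rest (n : ℕ) (y : ℝ) :
    P.rest n y - P.rest (n + 1) y = -((digit n y : ℤ) * (1 / 4 - P.scale n) / 2 ^ n) := by
  rw [rest_succ, rest, tail_succ]
  ring

lemma abs_rest_sub_rest_le (n : ℕ) (y : ℝ) : |P.rest n y - P.rest (n + 1) y| ≤ (1 / 2) ^ n := by
  have hs := P.scale_pos n
  have hs' := P.scale_lt n
  rw [rest_sub_rest, abs_neg, abs_div, abs_mul, abs_units_coe, one_mul, abs_of_pos (by linarith),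
    abs_of_pos (by positivity), one_div_pow]
  gcongr
  linarith

lemma tendsto_rest (y : ℝ) : Tendsto (P.rest · y) atTop (𝓝 y) := by
  have hgeom : Tendsto (fun n : ℕ => ((1 / 2 : ℝ) ^ n)) atTop (𝓝 0) :=
    tendsto_pow_atTop_nhds_zero_of_lt_one (by norm_num) (by norm_num)
  refine tendsto_iff_dist_tendsto_zero.2
    (squeeze_zero (fun _ => dist_nonneg) (fun n => ?_) (mul_zero (2 : ℝ) ▸ hgeom.const_mul 2))
  have hs := P.scale_pos n
  have htail : |P.scale n * P.tail n y / 2 ^ n| ≤ (1 / 2) ^ n := by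
    rw [abs_div, abs_mul, abs_of_pos hs, abs_of_pos (by positivity : (0 : ℝ) < 2 ^ n),
      one_div_pow]
    gcongr
    nlinarith [P.scale_le n, P.abs_tail_le n y]
  calc dist (P.rest n y) y
      = |cellCenter n y - y + P.scale n * P.tail n y / 2 ^ n| := by
        rw [Real.dist_eq, rest, add_sub_right_comm]
    _ ≤ (1 / 2) ^ n + (1 / 2) ^ n :=
        (abs_add_le _ _).trans (add_le_add (abs_cellCenter_sub_le n y) htail)
    _ = 2 * (1 / 2) ^ n := (two_mul _).symm

lemma tsum_rest_sub_rest (y : ℝ) : ∑' n, (P.rest n y - P.rest (n + 1) y) = P.rest 0 y - y := by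
  have hsum : Summable fun n => P.rest n y - P.rest (n + 1) y :=
    .of_norm_bounded (summable_geometric_of_lt_one (by norm_num) (by norm_num))
      fun n => P.abs_rest_sub_rest_le n y
  refine tendsto_nhds_unique hsum.hasSum.tendsto_sum_nat ?_
  simp only [Finset.sum_range_sub']
  exact (P.tendsto_rest y).const_sub _

/-- The motion of the `i`-th coordinate with initial value `y`. -/
def coord (i : Fin d) (y t : ℝ) : ℝ :=
  P.rest 0 y - ∑' n, (P.rest n y - P.rest (n + 1) y) * (1 - P.step (P.Q ^ (n * d + i) * t))

lemma coord_zero (i : Fin d) (y : ℝ) : P.coord i y 0 = y := by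
  have hstep : P.step 0 = 0 := P.step_eq_zero (by simpa using P.T_pos.le)
  simp only [coord, mul_zero, hstep, sub_zero, mul_one, tsum_rest_sub_rest, sub_sub_cancel]

lemma step_pow_mul_T (m : ℕ) : P.step (P.Q ^ m * P.T) = 1 :=
  P.step_eq_one (le_mul_of_one_le_left P.T_pos.le (one_le_pow₀ P.one_lt_Q.le))

lemma coord_T (i : Fin d) (y : ℝ) : P.coord i y P.T = P.rest 0 y := by
  simp only [coord, step_pow_mul_T, sub_self, mul_zero, tsum_zero, sub_zero]

lemma index_lt {n n' : ℕ} (h : n < n') (i j : Fin d) : n * d + i < n' * d + j :=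
  calc n * d + i < (n + 1) * d := by rw [add_one_mul]; omega
    _ ≤ n' * d + j := (Nat.mul_le_mul_right d h).trans (Nat.le_add_right _ _)

section

variable {P} {n : ℕ} {j : Fin d} {t : ℝ} (h : deriv P.step (P.Q ^ (n * d + j) * t) ≠ 0)

include h

lemma coord_eq_rest (i : Fin d) (y : ℝ) :
    P.coord i y t = P.rest (n + 1) y +
      (P.rest n y - P.rest (n + 1) y) * P.step (P.Q ^ (n * d + i) * t) := by
  have hsum : ∑' k, (P.rest k y - P.rest (k + 1) y) * (1 - P.step (P.Q ^ (k * d + i) * t)) =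
      P.rest 0 y - P.rest n y +
        (P.rest n y - P.rest (n + 1) y) * (1 - P.step (P.Q ^ (n * d + i) * t)) := by
    rw [tsum_eq_sum (s := Finset.range (n + 1)) fun k hk => ?_, Finset.sum_range_succ,
      ← Finset.sum_range_sub' (P.rest · y)]
    · congr 1
      refine Finset.sum_congr rfl fun k hk => ?_
      rw [step_eq_zero_of_gt h (index_lt (Finset.mem_range.1 hk) i j), sub_zero, mul_one]
    · have hnk : n < k := by rwa [Finset.mem_range, not_lt] at hk
      rw [step_eq_one_of_lt h (index_lt hnk j i), sub_self, mul_zero]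
  rw [coord, hsum]
  ring

lemma coord_eq (i : Fin d) (y : ℝ) :
    P.coord i y t = cellCenter n y +
      ((digit n y : ℤ) * P.radius n i t + P.scale n * (P.κ * P.tail (n + 1) y)) / 2 ^ n := by
  rw [coord_eq_rest h, rest_sub_rest, rest_succ, radius]
  ring

end

section

variable {P} (hrate : Summable fun n => P.rate n / 2 ^ n)

lemma IsBound.norm_digit_mul_speed_le {M : ℝ} (hM : P.IsBound M) (n : ℕ) (i : Fin d) (y t : ℝ) :
    ‖(digit n y : ℤ) * P.speed n i t‖ ≤ M * (P.rate n / 2 ^ n) := by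
  rw [norm_mul, Real.norm_eq_abs, abs_units_coe, one_mul]
  exact (hM.isControlled_speed n i).norm_le t

include hrate

lemma hasDerivAt_coord (i : Fin d) (y t : ℝ) :
    HasDerivAt (P.coord i y) (∑' n, (digit n y : ℤ) * P.speed n i t) t := by
  obtain ⟨M, hM⟩ := P.exists_isBound
  have hterm : ∀ (n : ℕ) (s : ℝ), HasDerivAt
      (fun s => (P.rest n y - P.rest (n + 1) y) * (1 - P.step (P.Q ^ (n * d + i) * s)))
      (-((digit n y : ℤ) * P.speed n i s)) s := by
    intro n s
    have hstep := (P.hasDerivAt_step (P.Q ^ (n * d + i) * s)).comp s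
      ((hasDerivAt_id s).const_mul (P.Q ^ (n * d + (i : ℕ))))
    refine ((hstep.const_sub 1).const_mul (P.rest n y - P.rest (n + 1) y)).congr_deriv ?_
    rw [rest_sub_rest, speed]
    ring
  have hsum := hasDerivAt_tsum (hrate.mul_left M) hterm
    (fun n s => (norm_neg _).trans_le (hM.norm_digit_mul_speed_le n i y s)) (y₀ := P.T)
    (by simpa only [step_pow_mul_T, sub_self, mul_zero] using summable_zero) t
  refine (hsum.const_sub (P.rest 0 y)).congr_deriv ?_
  rw [tsum_neg, neg_neg]

lemma exists_lipschitzWith_coord : ∃ K, ∀ (i : Fin d) (y : ℝ), LipschitzWith K (P.coord i y) := by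
  obtain ⟨M, hM⟩ := P.exists_isBound
  refine ⟨(∑' n, M * (P.rate n / 2 ^ n)).toNNReal, fun i y =>
    lipschitzWith_of_nnnorm_deriv_le (fun t => (hasDerivAt_coord hrate i y t).differentiableAt)
      fun t => NNReal.le_toNNReal_of_coe_le ?_⟩
  rw [coe_nnnorm, (hasDerivAt_coord hrate i y t).deriv]
  exact tsum_of_norm_bounded (hrate.mul_left M).hasSum
    fun n => hM.norm_digit_mul_speed_le n i y t

end

lemma radius_le (n : ℕ) (i : Fin d) (t : ℝ) : P.radius n i t ≤ 1 / 4 :=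
  sub_le_self _ (mul_nonneg (sub_nonneg.2 (P.scale_lt n).le) (P.step_nonneg _))

lemma scale_le_radius (n : ℕ) (i : Fin d) (t : ℝ) : P.scale n ≤ P.radius n i t := by
  rw [radius, le_sub_comm]
  exact mul_le_of_le_one_right (sub_nonneg.2 (P.scale_lt n).le) (P.step_le_one _)

lemma abs_scale_mul_le (n n' : ℕ) (y : ℝ) :
    |P.scale n * (P.κ * P.tail n' y)| ≤ P.scale n := by
  rw [abs_mul, abs_of_pos (P.scale_pos n)]
  exact mul_le_of_le_one_right (P.scale_pos n).le
    ((P.abs_κ_mul_tail_le n' y).trans (by linarith [P.κ_lt]))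

/-- The point of the torus all of whose coordinates are `β`. -/
def diagonal (d : ℕ) (β : ℝ) : Torus d := fun _ => (β : UnitAddCircle)

/-- The curve with initial coordinates `β + y i`. -/
def curve (β : ℝ) (y : Fin d → ℝ) (t : ℝ) : Torus d := fun i =>
  ((β + P.coord i (y i) t : ℝ) : UnitAddCircle)

section

variable {P} {n : ℕ} {j : Fin d} {t : ℝ} (h : deriv P.step (P.Q ^ (n * d + j) * t) ≠ 0)

include h

lemma nsmul_curve_sub_apply (β β' : ℝ) (y : Fin d → ℝ) (i : Fin d) :
    ((2 ^ n : ℕ) • (P.curve β y t - diagonal d β')) i =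
      ((1 / 2 + (digit n (y i) : ℤ) * P.radius n i t + P.scale n * (P.κ * P.tail (n + 1) (y i)) +
        2 ^ n * (β - β') : ℝ) : UnitAddCircle) := by
  rw [Pi.smul_apply, Pi.sub_apply, curve, diagonal, ← AddCircle.coe_sub, ← AddCircle.coe_nsmul,
    coord_eq h, ← coe_sub_intCast _ ⌊2 ^ n * y i⌋, cellCenter]
  congr 1
  rw [nsmul_eq_mul]
  push_cast
  field_simp
  ring

lemma stream_curve (β : ℝ) (y : Fin d → ℝ) (m : Fin d → ℕ) :
    P.stream (diagonal d β) n j m t (P.curve β y t) =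
      (digit n (y j) : ℤ) *
        ∏ i, iteratedDeriv (m i) (P.profile j i) (P.κ * P.tail (n + 1) (y i)) := by
  have hsign : ∏ i, (if digit n (y i) = 1 then 1 else if i = j then -1 else 1 : ℝ) =
      (digit n (y j) : ℤ) := by
    rw [Finset.prod_eq_single_of_mem j (Finset.mem_univ j) fun i _ hij => by simp [hij]]
    rcases Int.units_eq_one_or (digit n (y j)) with hd | hd <;> simp [hd]
  rw [← hsign, ← Finset.prod_mul_distrib]
  refine Finset.prod_congr rfl fun i _ => ?_
  rw [nsmul_curve_sub_apply h, sub_self, mul_zero, add_zero,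
    ((P.isBump_profile j i).iteratedDeriv (m i)).pairBump_coe (P.scale_pos n)
      (P.scale_le_radius n i t) (P.radius_le n i t) (P.abs_scale_mul_le n (n + 1) (y i)),
    mul_div_cancel_left₀ _ (P.scale_pos n).ne']

lemma stream_single_partner_curve (β : ℝ) (y : Fin d → ℝ) :
    P.stream (diagonal d β) n j (Pi.single (P.partner j) 1) t (P.curve β y t) =
      (digit n (y j) : ℤ) := by
  rw [stream_curve h, Finset.prod_eq_one, mul_one]
  intro i _
  have htail := P.abs_κ_mul_tail_le (n + 1) (y i)
  by_cases hi : i = P.partner j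
  · rw [hi, Pi.single_eq_same, iteratedDeriv_one, profile, if_pos rfl, ← hi, deriv_ζ_eq_one htail]
  · rw [Pi.single_eq_of_ne hi, iteratedDeriv_zero, profile, if_neg hi, η_eq_one htail]

lemma stream_single_curve (β : ℝ) (y : Fin d → ℝ) :
    P.stream (diagonal d β) n j (Pi.single j 1) t (P.curve β y t) = 0 := by
  rw [stream_curve h, Finset.prod_eq_zero (Finset.mem_univ j), mul_zero]
  rw [Pi.single_eq_same, iteratedDeriv_one, profile, if_neg (P.partner_ne j).symm,
    deriv_η_eq_zero (P.abs_κ_mul_tail_le (n + 1) (y j))]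

end

lemma deriv_step_ne_zero_of_speed_ne_zero {P : Setup d} {n : ℕ} {j : Fin d} {t : ℝ}
    (h : P.speed n j t ≠ 0) : deriv P.step (P.Q ^ (n * d + j) * t) ≠ 0 := by
  contrapose! h
  rw [speed, h, mul_zero, neg_zero]

lemma block_curve (β : ℝ) (y : Fin d → ℝ) (n : ℕ) (j : Fin d) (t : ℝ) :
    P.block (diagonal d β) n j t (P.curve β y t) =
      ((digit n (y j) : ℤ) * P.speed n j t) • EuclideanSpace.single j (1 : ℝ) := by
  by_cases hspeed : P.speed n j t = 0
  · rw [block, flow_eq_zero_of_speed_eq_zero hspeed, hspeed, mul_zero, zero_smul, Pi.zero_apply]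
  · have h := deriv_step_ne_zero_of_speed_ne_zero hspeed
    rw [block, flow, zero_add, zero_add, stream_single_partner_curve h, stream_single_curve h,
      zero_smul, sub_zero, smul_smul, mul_comm]

lemma field_curve (β : ℝ) (y : Fin d → ℝ) (t : ℝ) (i : Fin d) :
    P.field (diagonal d β) t (P.curve β y t) i = ∑' n, (digit n (y i) : ℤ) * P.speed n i t := by
  obtain ⟨⟨n, j⟩, hm⟩ := P.exists_speed_eq_zero t
  have hfield : P.field (diagonal d β) t (P.curve β y t) =
      P.block (diagonal d β) n j t (P.curve β y t) := by
    rw [field_apply]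
    refine tsum_eq_single (n, j) fun m' hne => ?_
    rw [block_curve, hm m' hne, mul_zero, zero_smul]
  have hsum : ∑' n, (digit n (y i) : ℤ) * P.speed n i t = (digit n (y i) : ℤ) * P.speed n i t :=
    tsum_eq_single n fun n' hne => by
      rw [hm (n', i) fun h => hne (congrArg Prod.fst h), mul_zero]
  rw [hfield, hsum, block_curve, PiLp.smul_apply, PiLp.single_apply, smul_eq_mul]
  split_ifs with hij
  · rw [hij, mul_one]
  · rw [mul_zero, hm (n, i) fun h => hij (congrArg Prod.snd h), mul_zero]

lemma isTrajectory_curve {P : Setup d} (hrate : Summable fun n => P.rate n / 2 ^ n) (β : ℝ)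
    (y : Fin d → ℝ) {u : ℝ → Torus d → Vec d}
    (hu : ∀ t, u t (P.curve β y t) = P.field (diagonal d β) t (P.curve β y t)) :
    IsTrajectory P.T u (fun i => ((β + y i : ℝ) : UnitAddCircle)) (P.curve β y) where
  absolutelyContinuous := by
    obtain ⟨K, hK⟩ := exists_lipschitzWith_coord hrate
    refine LipschitzOnWith.absolutelyContinuousOnInterval (K := K)
      (LipschitzOnWith.of_dist_le_mul fun t _ t' _ => ?_)
    refine (dist_pi_le_iff (by positivity)).2 fun i => (dist_coe_coe_le _ _).trans ?_
    rw [dist_add_left]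
    exact (hK i (y i)).dist_le_mul t t'
  start := by
    funext i
    rw [curve, coord_zero]
  ode := by
    refine ⟨fun t => WithLp.toLp 2 fun i => β + P.coord i (y i) t, fun t _ => rfl, fun t _ => ?_⟩
    have hderiv : HasDerivAt (fun t i => β + P.coord i (y i) t)
        (fun i => u t (P.curve β y t) i) t := by
      refine hasDerivAt_pi.2 fun i => ?_
      rw [hu, field_curve]
      exact (hasDerivAt_coord hrate i (y i) t).const_add β
    exact ((PiLp.hasFDerivAt_toLp (𝕜 := ℝ) 2 _).comp_hasDerivAt t hderiv).hasDerivWithinAt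

/-! ### Shifts by one third -/

/-- Doubling removes the contribution of `r`, up to `4 * l`. -/
lemma le_norm_coe_add_third {l r e : ℝ} (hl : l ≤ 1 / 128) (hr : r = 1 / 4 ∨ r = l)
    (he : |e| ≤ l) {m : ℤ} (hm : ¬ 3 ∣ m) (s σ : ℤˣ) :
    l ≤ ‖((((s : ℤ) - (σ : ℤ)) * r + e + m / 3 : ℝ) : UnitAddCircle)‖ := by
  set x : ℝ := ((s : ℤ) - (σ : ℤ)) * r + e + m / 3 with hx
  obtain ⟨w, hw⟩ : ∃ w : ℤ, |2 * (((s : ℤ) - (σ : ℤ)) * r) - w| ≤ 4 * l := by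
    have hl0 : 0 ≤ l := (abs_nonneg e).trans he
    rcases hr with rfl | rfl
    · obtain ⟨w, hw⟩ : ∃ w : ℤ, (s : ℤ) - (σ : ℤ) = 2 * w := by
        rcases Int.units_eq_one_or s with rfl | rfl <;>
          rcases Int.units_eq_one_or σ with rfl | rfl
        exacts [⟨0, rfl⟩, ⟨1, rfl⟩, ⟨-1, rfl⟩, ⟨0, rfl⟩]
      refine ⟨w, ?_⟩
      have hw' : ((s : ℤ) - (σ : ℤ) : ℝ) = 2 * w := by exact_mod_cast hw
      rw [hw', show 2 * (2 * (w : ℝ) * (1 / 4)) - w = 0 by ring, abs_zero]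
      positivity
    · refine ⟨0, ?_⟩
      have hsσ : |((s : ℤ) - (σ : ℤ) : ℝ)| ≤ 2 :=
        (abs_sub _ _).trans_eq (by rw [abs_units_coe, abs_units_coe, one_add_one_eq_two])
      rw [Int.cast_zero, sub_zero, abs_mul, abs_mul, abs_two, abs_of_nonneg hl0]
      linarith [mul_le_mul_of_nonneg_right hsσ hl0]
  have hm' : ¬ 3 ∣ 2 * m := by omega
  have hsplit : (((2 * m : ℤ) / 3 : ℝ) : UnitAddCircle) =
      (2 : ℕ) • (x : UnitAddCircle) - ((2 * (((s : ℤ) - (σ : ℤ)) * r) - w + 2 * e : ℝ)) := by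
    rw [← AddCircle.coe_nsmul, ← AddCircle.coe_sub, ← coe_sub_intCast _ (-w), hx]
    congr 1
    rw [nsmul_eq_mul]
    push_cast
    ring
  have hupper : ‖(((2 * m : ℤ) / 3 : ℝ) : UnitAddCircle)‖ ≤
      2 * ‖(x : UnitAddCircle)‖ + (4 * l + 2 * l) := by
    rw [hsplit]
    refine (norm_sub_le _ _).trans (add_le_add (norm_nsmul_le.trans_eq (by norm_num)) ?_)
    refine ((norm_coe_le_abs _).trans (abs_add_le _ _)).trans (add_le_add hw ?_)
    rw [abs_mul, abs_two]
    linarith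
  linarith [third_le_norm_coe hm']

lemma radius_eq_of_deriv_step_ne_zero {P : Setup d} {n : ℕ} {i j : Fin d} {t : ℝ}
    (h : deriv P.step (P.Q ^ (n * d + j) * t) ≠ 0) (hij : i ≠ j) :
    P.radius n i t = 1 / 4 ∨ P.radius n i t = P.scale n := by
  rcases lt_or_gt_of_ne hij with hlt | hgt
  · left
    rw [radius, step_eq_zero_of_gt h (Nat.add_lt_add_left hlt _), mul_zero, sub_zero]
  · right
    rw [radius, step_eq_one_of_lt h (Nat.add_lt_add_left hgt _), mul_one, sub_sub_cancel]

lemma field_curve_eq_zero {β β' : ℝ} {ε : ℤ} (hε : ¬ 3 ∣ ε) (hβ : β - β' = ε / 3)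
    (y : Fin d → ℝ) (t : ℝ) : P.field (diagonal d β') t (P.curve β y t) = 0 := by
  rw [field_apply]
  refine (tsum_congr fun ⟨n, j⟩ => ?_).trans tsum_zero
  by_cases hspeed : P.speed n j t = 0
  · rw [block, flow_eq_zero_of_speed_eq_zero hspeed, Pi.zero_apply]
  have h := deriv_step_ne_zero_of_speed_ne_zero hspeed
  set i := P.partner j
  have hm : ¬ 3 ∣ 2 ^ n * ε := fun hdvd => (Int.prime_three.dvd_or_dvd hdvd).elim
    (fun h2 => absurd (Int.prime_three.dvd_of_dvd_pow h2) (by norm_num)) hε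
  have hfar : ∀ σ : ℤˣ, P.scale n ≤ ‖((2 ^ n : ℕ) • (P.curve β y t - diagonal d β')) i -
      ((1 / 2 + (σ : ℤ) * P.radius n i t : ℝ) : UnitAddCircle)‖ := by
    intro σ
    convert le_norm_coe_add_third (P.scale_le n)
      (radius_eq_of_deriv_step_ne_zero h (P.partner_ne j))
      (P.abs_scale_mul_le n (n + 1) (y i)) hm (digit n (y i)) σ using 2
    rw [nsmul_curve_sub_apply h, ← AddCircle.coe_sub, hβ]
    congr 1
    push_cast
    ring
  exact flow_eq_zero i (by simpa using hfar 1) (by simpa [← sub_eq_add_neg] using hfar (-1)) j 0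

end Setup

/-! ### The Cantor set -/

lemma volume_closedCube_le {d : ℕ} (c : Torus d) (l : ℝ) :
    volume (closedCube c l) ≤ ENNReal.ofReal l ^ d := by
  have hpi : closedCube c l = Set.pi univ fun j => Metric.closedBall (c j) (l / 2) := by
    ext x
    simp [closedCube, dist_eq_norm]
  rw [hpi, volume_pi_pi]
  refine (Finset.prod_le_pow_card _ _ (ENNReal.ofReal l) fun j _ => ?_).trans_eq (by simp)
  exact (volume_closedBall_le (c j) (l / 2)).trans_eq (by rw [mul_div_cancel₀ l two_ne_zero])

lemma volume_cantorStage_le (d : ℕ) (ν : ℝ) (n : ℕ) :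
    volume (cantorStage d ν n) ≤ ENNReal.ofReal (2 ^ (-ν * n)) ^ d := by
  have hcard : Fintype.card (Fin n → Fin d → ℤˣ) = (2 ^ n) ^ d := by
    simp only [Fintype.card_fun, Fintype.card_fin, Fintype.card_units_int, pow_right_comm]
  have hlength : (2 ^ n : ℝ) * cubeLength ν n = 2 ^ (-ν * n) := by
    rw [cubeLength, ← Real.rpow_natCast, ← Real.rpow_add two_pos]
    ring_nf
  calc volume (cantorStage d ν n)
      ≤ ∑' s : Fin n → Fin d → ℤˣ, volume (closedCube (cubeCenter ν n s) (cubeLength ν n)) :=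
        measure_iUnion_le _
    _ ≤ ∑ _ : Fin n → Fin d → ℤˣ, ENNReal.ofReal (cubeLength ν n) ^ d := by
        rw [tsum_fintype]
        exact Finset.sum_le_sum fun s _ => volume_closedCube_le _ _
    _ = ENNReal.ofReal (2 ^ (-ν * n)) ^ d := by
        rw [Finset.sum_const, Finset.card_univ, hcard, nsmul_eq_mul, Nat.cast_pow, ← mul_pow,
          ← hlength, ENNReal.ofReal_mul (by positivity), ENNReal.ofReal_pow two_pos.le]
        simp

lemma volume_cantorSet {d : ℕ} (hd : d ≠ 0) {ν : ℝ} (hν : 0 < ν) :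
    volume (cantorSet d ν) = 0 := by
  have hlim : Tendsto (fun n : ℕ => ENNReal.ofReal (2 ^ (-ν * n)) ^ d) atTop (𝓝 0) := by
    have hgeom := tendsto_pow_atTop_nhds_zero_of_lt_one (by positivity)
      (Real.rpow_lt_one_of_one_lt_of_neg one_lt_two (neg_lt_zero.2 hν))
    simp only [Real.rpow_mul_natCast two_pos.le]
    simpa [hd] using ENNReal.Tendsto.pow (n := d) (ENNReal.tendsto_ofReal hgeom)
  refine le_antisymm (ge_of_tendsto hlim ?_) zero_le
  filter_upwards [eventually_ge_atTop 1] with n hn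
  exact (measure_mono (biInter_subset_of_mem hn)).trans (volume_cantorStage_le d ν n)

namespace Setup

variable {d : ℕ} (P : Setup d)

lemma mem_cantorSet (s : Fin d → ℕ → ℤˣ) :
    (fun j => ((1 / 2 + 1 / 4 * ∑' k, (s j k : ℤ) * P.κ ^ k : ℝ) : UnitAddCircle)) ∈
      cantorSet d P.ν := by
  refine mem_iInter₂.2 fun n _ => mem_iUnion.2 ⟨fun k j => s j k, fun j => ?_⟩
  have hκ := P.κ_pos
  have hsplit : ∑' k, ((s j k : ℤ) * P.κ ^ k : ℝ) = ∑ k : Fin n, (s j k : ℤ) * P.κ ^ (k : ℕ) +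
      P.κ ^ n * ∑' k, (s j (k + n) : ℤ) * P.κ ^ k := by
    rw [← (summable_units_mul_pow hκ.le (s j) P.κ_lt_one).sum_add_tsum_nat_add n,
      Fin.sum_univ_eq_sum_range fun k => ((s j k : ℤ) * P.κ ^ k : ℝ), ← tsum_mul_left]
    congr 2
    funext k
    rw [pow_add]
    ring
  simp only [cubeCenter, P.cubeLength_eq]
  rw [hsplit, ← AddCircle.coe_sub, add_sub_add_left_eq_sub, ← mul_sub, add_sub_cancel_left]
  calc ‖((1 / 4 * (P.κ ^ n * ∑' k, (s j (k + n) : ℤ) * P.κ ^ k) : ℝ) : UnitAddCircle)‖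
      ≤ |1 / 4 * (P.κ ^ n * ∑' k, (s j (k + n) : ℤ) * P.κ ^ k)| := norm_coe_le_abs _
    _ = 1 / 4 * (P.κ ^ n * |∑' k, (s j (k + n) : ℤ) * P.κ ^ k|) := by
        rw [abs_mul, abs_mul, abs_of_pos (pow_pos hκ n), abs_of_pos (by norm_num)]
    _ ≤ 1 / 4 * (P.κ ^ n * 2) := by
        gcongr
        exact P.abs_tsum_units_mul_κ_pow_le fun k => s j (k + n)
    _ = P.κ ^ n / 2 := by ring

/-- The coordinate of the origin of the dyadic cells, chosen such that the center `origin + 1 / 2`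
of the cell of generation `0` is the center of a cube of generation `5` of the Cantor set. -/
def origin : ℝ := 1 / 4 * ∑ k ∈ Finset.range 5, P.κ ^ k

/-- The encoding of the final positions of the curves: the digits of `y` inside a cube of
generation `5`. -/
def code (y : ℝ) (k : ℕ) : ℤˣ := if k < 5 then 1 else digit (k - 5) y

lemma rest_zero {y : ℝ} (hy : y ∈ Ico 0 1) : P.rest 0 y = 1 / 2 + P.κ ^ 5 / 4 * P.tail 0 y := by
  simp [rest, cellCenter, scale, Int.floor_eq_zero_iff.2 hy]

lemma origin_add_rest_zero {y : ℝ} (hy : y ∈ Ico 0 1) :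
    P.origin + P.rest 0 y = 1 / 2 + 1 / 4 * ∑' k, (code y k : ℤ) * P.κ ^ k := by
  have hhead : ∑ k ∈ Finset.range 5, ((code y k : ℤ) * P.κ ^ k : ℝ) =
      ∑ k ∈ Finset.range 5, P.κ ^ k :=
    Finset.sum_congr rfl fun k hk => by simp [code, Finset.mem_range.1 hk]
  have htail : ∑' k, ((code y (k + 5) : ℤ) * P.κ ^ (k + 5) : ℝ) = P.κ ^ 5 * P.tail 0 y := by
    rw [tail, ← tsum_mul_left]
    refine tsum_congr fun k => ?_
    rw [code, if_neg (by omega), Nat.add_sub_cancel, zero_add, pow_add]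
    ring
  rw [← (summable_units_mul_pow P.κ_pos.le (code y) P.κ_lt_one).sum_add_tsum_nat_add 5, hhead,
    htail, origin, P.rest_zero hy]
  ring

lemma curve_T_mem_cantorSet {y : Fin d → ℝ} (hy : ∀ i, y i ∈ Ico 0 1) :
    P.curve P.origin y P.T ∈ cantorSet d P.ν := by
  convert P.mem_cantorSet fun j => code (y j) using 2 with j
  rw [curve, coord_T, origin_add_rest_zero P (hy j)]

lemma curve_T_ne {y y' : Fin d → ℝ} (hy : ∀ i, y i ∈ Ico 0 1) (hy' : ∀ i, y' i ∈ Ico 0 1) (β : ℝ) :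
    P.curve β y P.T ≠ P.curve (β + 1 / 3) y' P.T := by
  intro heq
  let i : Fin d := ⟨0, by linarith [P.two_le]⟩
  have hnear : ∀ z ∈ Ico (0 : ℝ) 1, |P.rest 0 z - 1 / 2| ≤ 1 / 64 := fun z hz => by
    have hκ : P.κ ^ 5 ≤ (1 / 2) ^ 5 := pow_le_pow_left₀ P.κ_pos.le P.κ_lt.le 5
    have hκ0 := pow_pos P.κ_pos 5
    rw [P.rest_zero hz, add_sub_cancel_left, abs_mul, abs_of_pos (by positivity)]
    nlinarith [P.abs_tail_le 0 z]
  have hcoe : ((1 / 3 + (P.rest 0 (y' i) - P.rest 0 (y i)) : ℝ) : UnitAddCircle) = 0 := by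
    rw [← sub_eq_zero.2 (congrFun heq i).symm, curve, curve, coord_T, coord_T, ← AddCircle.coe_sub]
    congr 1
    ring
  have hthird : (((1 : ℤ) / 3 : ℝ) : UnitAddCircle) =
      ((P.rest 0 (y i) - P.rest 0 (y' i) : ℝ) : UnitAddCircle) := by
    rw [← sub_eq_zero, ← AddCircle.coe_sub, ← hcoe]
    congr 1
    push_cast
    ring
  have hfar := third_le_norm_coe (m := 1) (by norm_num)
  rw [hthird] at hfar
  have hle := hfar.trans ((norm_coe_le_abs _).trans (abs_sub_le _ (1 / 2) _))
  rw [abs_sub_comm (1 / 2)] at hle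
  linarith [hnear _ (hy i), hnear _ (hy' i)]

/-! ### Two copies of the field -/

/-- The coordinates of `x`, relative to `β`, in `[0,1)`. -/
def offset (β : ℝ) (x : Torus d) (i : Fin d) : ℝ :=
  AddCircle.equivIco 1 0 (x i - (β : UnitAddCircle))

lemma offset_mem (β : ℝ) (x : Torus d) (i : Fin d) : offset β x i ∈ Ico 0 1 := by
  have h := (AddCircle.equivIco (1 : ℝ) 0 (x i - (β : UnitAddCircle))).2
  exact ⟨h.1, h.2.trans_eq (zero_add 1)⟩

lemma coe_add_offset (β : ℝ) (x : Torus d) :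
    (fun i => ((β + offset β x i : ℝ) : UnitAddCircle)) = x := by
  funext i
  rw [AddCircle.coe_add, offset, AddCircle.coe_equivIco, add_sub_cancel]

/-- The vector field with nonunique trajectories: two copies of `field`, with origins that differ
by `1 / 3`, so that the curves of each copy never meet the moving cubes of the other one. -/
def velocity (t : ℝ) : Torus d → Vec d :=
  P.field (diagonal d P.origin) t + P.field (diagonal d (P.origin + 1 / 3)) t

lemma hasGradient_velocity (t : ℝ) : HasGradient (P.velocity t)
    (P.fieldGrad (diagonal d P.origin) t + P.fieldGrad (diagonal d (P.origin + 1 / 3)) t) :=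
  (P.hasGradient_field _ t).add (P.hasGradient_field _ t)

lemma isDivergenceFree_velocity (t : ℝ) : IsDivergenceFree (P.velocity t) :=
  (P.hasGradient_velocity t).isDivergenceFree fun x => by
    simp only [Pi.add_apply, PiLp.add_apply, Finset.sum_add_distrib, P.sum_fieldGrad, add_zero]

lemma isContinuousInW1p_velocity {p : ℝ} (hp : 1 ≤ p)
    (hrate : Tendsto (fun n => P.rate n / 2 ^ n) atTop (𝓝 0))
    (hrate' : Tendsto (fun n => P.rate n * P.scale n ^ (d / p - 1)) atTop (𝓝 0)) (T : ℝ) :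
    IsContinuousInW1p (ENNReal.ofReal p) T P.velocity := by
  have hp' : 1 ≤ ENNReal.ofReal p := ENNReal.one_le_ofReal.2 hp
  have hfield : ∀ b t, AEStronglyMeasurable (P.field b t) := fun b t =>
    (integrable_of_continuous (P.hasGradient_field b t).continuous).aestronglyMeasurable
  have hgrad : ∀ b i t, AEStronglyMeasurable (P.fieldGrad b t i) := fun b i t =>
    (integrable_of_continuous ((P.hasGradient_field b t).continuous_grad i)).aestronglyMeasurable
  exact isContinuousInW1p_of_hasGradient P.hasGradient_velocity
    (fun t => tendsto_eLpNorm_add_sub hp' (hfield _) (hfield _)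
      (P.tendsto_eLpNorm_field_sub hp' hrate _ t) (P.tendsto_eLpNorm_field_sub hp' hrate _ t))
    fun t i => tendsto_eLpNorm_add_sub hp' (hgrad _ i) (hgrad _ i)
      (P.tendsto_eLpNorm_fieldGrad_sub hp hrate' _ i t)
      (P.tendsto_eLpNorm_fieldGrad_sub hp hrate' _ i t)

lemma isHolder_velocity {α : ℝ} (h0 : 0 ≤ α) (h1 : α ≤ 1) {C : ℝ}
    (hC : ∀ n, P.rate n / 2 ^ n * (2 ^ n * P.rate n / P.scale n) ^ α ≤ C) (T : ℝ) :
    IsHolder α.toNNReal T P.velocity := by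
  obtain ⟨K, hK⟩ := P.exists_holderWith_field h0 h1 hC (diagonal d P.origin)
  obtain ⟨K', hK'⟩ := P.exists_holderWith_field h0 h1 hC (diagonal d (P.origin + 1 / 3))
  exact ⟨K + K', (hK.add hK').holderOnWith _⟩

section

variable {P} (hrate : Summable fun n => P.rate n / 2 ^ n)

include hrate

lemma isTrajectory_velocity (x : Torus d) :
    IsTrajectory P.T P.velocity x (P.curve P.origin (offset P.origin x)) := by
  have h := isTrajectory_curve hrate P.origin (offset P.origin x) (u := P.velocity) fun t => by
    rw [velocity, Pi.add_apply, P.field_curve_eq_zero (β' := P.origin + 1 / 3) (ε := -1)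
      (by norm_num) (by push_cast; ring), add_zero]
  rwa [coe_add_offset] at h

lemma isTrajectory_velocity_shift (x : Torus d) : IsTrajectory P.T P.velocity x
    (P.curve (P.origin + 1 / 3) (offset (P.origin + 1 / 3) x)) := by
  have h := isTrajectory_curve hrate (P.origin + 1 / 3) (offset (P.origin + 1 / 3) x)
    (u := P.velocity) fun t => by
      rw [velocity, Pi.add_apply, P.field_curve_eq_zero (β' := P.origin) (ε := 1)
        (by norm_num) (by push_cast; ring), zero_add]
  rwa [coe_add_offset] at h

lemma mem_nonuniquenessSet (x : Torus d) : x ∈ nonuniquenessSet P.T P.velocity :=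
  ⟨_, _, isTrajectory_velocity hrate x, isTrajectory_velocity_shift hrate x, P.T,
    ⟨P.T_pos.le, le_rfl⟩, P.curve_T_ne (offset_mem _ x) (offset_mem _ x) P.origin⟩

end

/-! ### Choice of the parameters -/

lemma two_mul_κ : 2 * P.κ = (2 : ℝ) ^ (-P.ν) := by
  rw [κ, neg_add, Real.rpow_add two_pos, Real.rpow_neg_one]
  ring

lemma exists_setup (hd : 2 ≤ d) {T ν ε : ℝ} (hT : 0 < T) (hν : 0 < ν) (hε : 0 < ε) :
    ∃ P : Setup d, P.T = T ∧ P.ν = ν ∧ P.Q ^ d = 2 ^ ε := by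
  have hd0 : (0 : ℝ) < d := by positivity
  refine ⟨⟨T, 2 ^ (ε / d), ν, hT, Real.one_lt_rpow one_lt_two (by positivity), hν, hd⟩,
    rfl, rfl, ?_⟩
  rw [← Real.rpow_mul_natCast two_pos.le, div_mul_cancel₀ _ hd0.ne']

section

variable {P} {ε : ℝ} (hQ : P.Q ^ d = 2 ^ ε)

include hQ

lemma rate_eq (n : ℕ) : P.rate n = 2 ^ ε * (2 ^ ε) ^ n := by
  rw [rate, mul_comm (n + 1), pow_mul, hQ, pow_succ']

lemma summable_rate (hε : ε < 1) : Summable fun n => P.rate n / 2 ^ n := by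
  have hlt : (2 : ℝ) ^ ε / 2 < 1 := by
    rw [← Real.rpow_sub_one two_ne_zero]
    exact Real.rpow_lt_one_of_one_lt_of_neg one_lt_two (by linarith)
  refine ((summable_geometric_of_lt_one (by positivity) hlt).mul_left (2 ^ ε)).congr fun n => ?_
  rw [rate_eq hQ, div_pow, mul_div_assoc]

lemma tendsto_rate_mul_scale {θ : ℝ} (hε : ε < P.ν * θ) :
    Tendsto (fun n => P.rate n * P.scale n ^ θ) atTop (𝓝 0) := by
  have hκ := P.κ_pos
  have hlt : (2 : ℝ) ^ ε * (2 * P.κ) ^ θ < 1 := by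
    rw [two_mul_κ, ← Real.rpow_mul two_pos.le, ← Real.rpow_add two_pos]
    exact Real.rpow_lt_one_of_one_lt_of_neg one_lt_two (by linarith)
  have hlim := (tendsto_pow_atTop_nhds_zero_of_lt_one (by positivity) hlt).const_mul
    (2 ^ ε * (P.κ ^ 5 / 4) ^ θ)
  rw [mul_zero] at hlim
  refine hlim.congr fun n => ?_
  rw [rate_eq hQ, scale, mul_div_right_comm,
    Real.mul_rpow (x := P.κ ^ 5 / 4) (by positivity) (by positivity), mul_pow _ ((2 * P.κ) ^ θ),
    Real.rpow_pow_comm (x := 2 * P.κ) (by positivity)]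
  ring

lemma exists_rate_mul_le {α : ℝ} (hε : (1 + α) * ε + α * (1 + P.ν) ≤ 1) :
    ∃ C, ∀ n, P.rate n / 2 ^ n * (2 ^ n * P.rate n / P.scale n) ^ α ≤ C := by
  have hκ := P.κ_pos
  set A : ℝ := 2 ^ ε
  have hA : 0 < A := by positivity
  have hratio : A / 2 * (A / P.κ) ^ α ≤ 1 := by
    have hexp : A / 2 * (A / P.κ) ^ α = 2 ^ ((1 + α) * ε + α * (1 + P.ν) - 1) := by
      rw [κ, ← Real.rpow_sub two_pos, ← Real.rpow_mul two_pos.le, ← Real.rpow_sub_one two_ne_zero,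
        ← Real.rpow_add two_pos]
      ring_nf
    rw [hexp]
    exact Real.rpow_le_one_of_one_le_of_nonpos one_le_two (by linarith)
  refine ⟨A * (A / (P.κ ^ 5 / 4)) ^ α, fun n => ?_⟩
  have hrate : P.rate n = A * A ^ n := rate_eq hQ n
  have hbase : 2 ^ n * P.rate n / P.scale n = A / (P.κ ^ 5 / 4) * (A / P.κ) ^ n := by
    rw [hrate, scale, mul_pow, div_pow]
    field_simp
  calc P.rate n / 2 ^ n * (2 ^ n * P.rate n / P.scale n) ^ α
      = A * (A / (P.κ ^ 5 / 4)) ^ α * (A / 2 * (A / P.κ) ^ α) ^ n := by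
        rw [hbase, hrate, Real.mul_rpow (by positivity) (by positivity),
          ← Real.rpow_pow_comm (by positivity), mul_pow, div_pow]
        ring
    _ ≤ A * (A / (P.κ ^ 5 / 4)) ^ α :=
        mul_le_of_le_one_right (by positivity) (pow_le_one₀ (by positivity) hratio)

end

end Setup

lemma exists_exponent {α θ : ℝ} (h0 : 0 ≤ α) (h1 : α < 1) (hθ : 0 < θ) :
    ∃ ε : ℝ, 0 < ε ∧ ε < 1 ∧ ε < (1 - α) / 2 * θ ∧
      (1 + α) * ε + α * (1 + (1 - α) / 2) ≤ 1 := by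
  have hα : 0 < 1 - α := by linarith
  obtain ⟨ε, hε0, hε⟩ := exists_between (lt_min (mul_pos (half_pos hα) hθ) (div_pos hα four_pos))
  obtain ⟨hεθ, hεα⟩ := lt_min_iff.1 hε
  exact ⟨ε, hε0, by linarith, hεθ, by nlinarith⟩

end TorusODE

open TorusODE in
theorem theorem1_general (d : ℕ) (hd : 2 ≤ d) (p : ℝ) (hp : 1 ≤ p) (hpd : p < d)
    (α : ℝ) (hα₀ : 0 ≤ α) (hα₁ : α < 1) (T : ℝ) (hT : 0 < T) :
    ∃ u : ℝ → Torus d → Vec d,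
      (∀ t, IsDivergenceFree (u t)) ∧
      IsContinuousInW1p (ENNReal.ofReal p) T u ∧
      IsHolder α.toNNReal T u ∧
      (∀ x, x ∈ nonuniquenessSet T u) ∧
      ∃ ν : ℝ, 0 < ν ∧ ν < 1 ∧ volume (cantorSet d ν) = 0 ∧
        ∃ X : ℝ → Torus d → Torus d,
          (∀ x, IsTrajectory T u x (fun t => X t x)) ∧ ∀ x, X T x ∈ cantorSet d ν := by
  have hθ : 0 < d / p - 1 := sub_pos.2 ((one_lt_div (by linarith)).2 hpd)
  obtain ⟨ε, hε0, hε1, hεθ, hεα⟩ := exists_exponent hα₀ hα₁ hθ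
  obtain ⟨P, rfl, hν, hQ⟩ := Setup.exists_setup hd hT (show 0 < (1 - α) / 2 by linarith) hε0
  rw [← hν] at hεθ hεα
  have hrate := Setup.summable_rate hQ hε1
  obtain ⟨C, hC⟩ := Setup.exists_rate_mul_le hQ hεα
  exact ⟨P.velocity, P.isDivergenceFree_velocity,
    P.isContinuousInW1p_velocity hp hrate.tendsto_atTop_zero
      (Setup.tendsto_rate_mul_scale hQ hεθ) P.T,
    P.isHolder_velocity hα₀ hα₁.le hC P.T, Setup.mem_nonuniquenessSet hrate,
    P.ν, P.ν_pos, by linarith, volume_cantorSet (by omega) P.ν_pos,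
    fun t x => P.curve P.origin (Setup.offset P.origin x) t,
    Setup.isTrajectory_velocity hrate, fun x => P.curve_T_mem_cantorSet (Setup.offset_mem _ x)⟩

end

theorem theorem1 (d : ℕ) (hd : 2 ≤ d) (p : ℝ) (hp : 1 ≤ p) (hpd : p < d)
    (α : ℝ) (hα₀ : 0 < α) (hα₁ : α < 1) (T : ℝ) (hT : 0 < T) :
    ∃ u : ℝ → TorusODE.Torus d → TorusODE.Vec d,
      (∀ t ∈ Set.Icc 0 T, TorusODE.IsDivergenceFree (u t)) ∧
      TorusODE.IsContinuousInW1p (ENNReal.ofReal p) T u ∧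
      TorusODE.IsHolder α.toNNReal T u ∧
      (∀ᵐ x : TorusODE.Torus d, x ∈ TorusODE.nonuniquenessSet T u) ∧
      ∃ ν : ℝ, 0 < ν ∧ ν < 1 ∧ MeasureTheory.volume (TorusODE.cantorSet d ν) = 0 ∧
        ∃ X : ℝ → TorusODE.Torus d → TorusODE.Torus d,
          (∀ x, TorusODE.IsTrajectory T u x (fun t => X t x)) ∧
          ∀ x, X T x ∈ TorusODE.cantorSet d ν := by
  obtain ⟨u, hdiv, hW, hα, hx, hX⟩ := theorem1_general d hd p hp hpd α hα₀.le hα₁ T hT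
  exact ⟨u, fun t _ => hdiv t, hW, hα, .of_forall hx, hX⟩
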